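/- Let $C,\mu_0>0$, let $u\in\mathbb R^3$ with $|u|<C$, put $\gamma=(1-|u|^2/C^2)^{-1/2}$, $\hat u=u/|u|$, and let $$L(u)(z,s)=\bigl(z+(\gamma-1)\hat u(\hat u\cdot z)+\gamma\tfrac{u}{C}s,\ \gamma(s+\tfrac{u\cdot z}{C})\bigr)$$ be the Lorentz boost (with $L(0)=\mathrm{id}$), acting on real and complex four-vectors; write $B_u(x,t)=(x',t')$ where $(x',Ct')=L(u)(x,Ct)$, and $W_{u}(k,w)=(k',w')$ where $(k',w'/C)=L(u)(k,w/C)$. For a current-charge $J=(j,C\rho):\mathbb R^3\times\mathbb R\to\mathbb C^4$ of Schwartz class, measured at rest relative to the source, the current-charge inferred by a detector with constant velocity $u$ relative to the source is $J_u=L(-u)\,(J\circ B_u)$, and the potentials perceived by it are the retarded potentials $$\Phi_u[J](x,t)=\bigl(A,\tfrac VC\bigr)_u(x,t)=\frac{\mu_0}{4\pi}\int_{\mathbb R^3}\frac{J_u(x-z,\,t-|z|/C)}{|z|}\,d^3z .$$ Let $\mathcal F_{k,w}[\phi]=(2\pi)^{-2}\iint e^{-i(k\cdot x-wt)}\phi(x,t)\,d^3x\,dt$,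 and let the spectrum $\mathcal F[\Phi]$ of a bounded continuous $\Phi$ be the tempered distribution $\langle\mathcal F[\Phi],g\rangle=\iint\Phi\,\mathcal F[g]\,d^3x\,dt$ in the variables $(k,w)$. Peaks. Let $\Omega\subset\mathbb R^3\times\mathbb R$ be open, $p\in\Omega$, and consider a family indexed by $i$ with a filter $l$ on the index set. A family $T_i$ of distributions *persists at* $p$ if for each neighbourhood $U$ of $p$ there are $g\in C_c^\infty(U)$ and $\delta>0$ with $|\langle T_i,g\rangle|\ge\delta$ eventually along $l$. It *peaks at* $p$ *in* $\Omega$ if it persists at $p$ and $\langle T_i,g\rangle\to0$ along $l$ for each $g\in C_c^\infty(\Omega\setminus\{p\})$. A family of Schwartz current-charges $J_i$ *emits waves of wave data* $p=(k,w)$ *in the spectral window* $\Omega$ if $\mathcal F[J_i]$ persists at $p$ and $\mathcal F[J_i]\to0$ on $\Omega\setminus\{p\}$, locally uniformly with all derivatives (for instance wave trains $\chi(x/R,t/R)\,e^{i(k\cdot x-wt)}a$ with $\chi$ of Schwartz class, $\chi(0)\neq0$, $a\ne0$, of length $R\to\infty$). **Theorem (Doppler effect).** (1) For every Schwartz current-charge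 $J$ the integral defining $\Phi_u[J]$ converges absolutely at each $(x,t)$, $\Phi_u[J]$ is bounded and continuous, and its spectrum satisfies: (a) $\langle\mathcal F[\Phi_u[J]],g\rangle=L(-u)\,\langle\mathcal F[\Phi_0[J]],g\circ W_{-u}\rangle$ for every Schwartz function $g$; (b) for every $g\in C_c^\infty(\{w^2\ne C^2|k|^2\})$, $$\langle\mathcal F[\Phi_u[J]],g\rangle=\int g(W_{-u}(k,w))\,\frac{\mu_0C^2}{C^2|k|^2-w^2}\,L(-u)\,\mathcal F_{k,w}[J]\,d^3k\,dw,$$ that is, the component of the source with wave data $(k,w)$ is perceived at $W_{-u}(k,w)$; (c) $\operatorname{supp}\mathcal F[\Phi_u[J]]=W_{-u}(\operatorname{supp}\mathcal F[J])$. (2) If a family $J_i$ emits waves of wave data $(k,w)$ in the open spectral window $\Omega$, then the spectra $\mathcal F[\Phi_u[J_i]]$ of the perceived potentials peak, in the window $W_{-u}(\Omega)$, at the wave data $(k',w')$ given by $$(k',w'/C)=L(-u)(k,w/C);$$ in particular $w'=\gamma\,(w-k\cdot u)$. -/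

import Mathlib

open scoped ContDiff

noncomputable section

namespace Doppler

/-- Euclidean three-space. -/
abbrev Space : Type := EuclideanSpace ℝ (Fin 3)

/-- Pairs (three-vector, number) over `𝕜`. -/
abbrev FourVec (𝕜 : Type) : Type := EuclideanSpace 𝕜 (Fin 3) × 𝕜

/-- Events `(x, t)`; also wave data `(k, w)` (wave vector, angular frequency). -/
abbrev Event : Type := Space × ℝ

/-- The factor `γ(u) = 1 / √(1 - |u|² / C²)`. -/
def gam (C : ℝ) (u : Space) : ℝ := 1 / Real.sqrt (1 - ‖u‖ ^ 2 / C ^ 2)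

/-- The unit vector `û = u / |u|` (and `0` for `u = 0`, where its coefficient in the boost
vanishes). -/
def unitVec (u : Space) : Space := ‖u‖⁻¹ • u

/-- The bilinear product `a · z = ∑ aᵢ zᵢ` of a real vector with a real or complex one. -/
def dot {𝕜 : Type} [RCLike 𝕜] (a : Space) (z : EuclideanSpace 𝕜 (Fin 3)) : 𝕜 :=
  ∑ i, (a i : 𝕜) * z i

/-- A real vector regarded as a vector over `𝕜`. -/
def castVec (𝕜 : Type) [RCLike 𝕜] (a : Space) : EuclideanSpace 𝕜 (Fin 3) :=
  WithLp.toLp 2 fun i => (a i : 𝕜)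

/-- The Lorentz boost
`L(u)(z, s) = (z + (γ - 1) û (û · z) + γ (u / C) s, γ (s + u · z / C))`,
acting on real four-vectors (`𝕜 = ℝ`) and on complex ones (`𝕜 = ℂ`). -/
def lorentz {𝕜 : Type} [RCLike 𝕜] (C : ℝ) (u : Space) (Z : FourVec 𝕜) : FourVec 𝕜 :=
  (Z.1 + (((gam C u - 1 : ℝ) : 𝕜) * dot (unitVec u) Z.1) • castVec 𝕜 (unitVec u)
      + (((gam C u / C : ℝ) : 𝕜) * Z.2) • castVec 𝕜 u,
    ((gam C u : ℝ) : 𝕜) * (Z.2 + dot u Z.1 / ((C : ℝ) : 𝕜)))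

/-- `(x, t) ↦ (x', t')` where `(x', C t') = L(u)(x, C t)`. -/
def boostEvent (C : ℝ) (u : Space) (X : Event) : Event :=
  ((lorentz (𝕜 := ℝ) C u (X.1, C * X.2)).1, (lorentz (𝕜 := ℝ) C u (X.1, C * X.2)).2 / C)

/-- `(k, w) ↦ (k', w')` where `(k', w' / C) = L(u)(k, w / C)`. -/
def boostWave (C : ℝ) (u : Space) (p : Event) : Event :=
  ((lorentz (𝕜 := ℝ) C u (p.1, p.2 / C)).1, C * (lorentz (𝕜 := ℝ) C u (p.1, p.2 / C)).2)

/-- The inferred current-charge `J_u(x, t) = L(-u) J(L(u)(x, t))`, where `J = (j, C ρ)` is the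
current-charge measured at rest relative to the source. -/
def inferred (C : ℝ) (u : Space) (J : Event → FourVec ℂ) (X : Event) : FourVec ℂ :=
  lorentz C (-u) (J (boostEvent C u X))

/-- The integrand `z ↦ J(x - z, t - |z| / C) / |z|` of the retarded potential. -/
def retardedIntegrand (C : ℝ) (J : Event → FourVec ℂ) (X : Event) (z : Space) : FourVec ℂ :=
  ‖z‖⁻¹ • J (X.1 - z, X.2 - ‖z‖ / C)

/-- The retarded (Lorenz) potentials of a current-charge:
`(A, V / C)(x, t) = μ₀ / (4 π) ∫ J(x - z, t - |z| / C) / |z| d³z`. -/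
def retarded (C μ₀ : ℝ) (J : Event → FourVec ℂ) (X : Event) : FourVec ℂ :=
  (μ₀ / (4 * Real.pi)) • ∫ z : Space, retardedIntegrand C J X z

/-- The potentials `(A, V / C)_u` perceived by a detector with velocity `u` relative to a source
with current-charge `J`: the retarded potentials of the inferred current-charge. -/
def perceived (C μ₀ : ℝ) (u : Space) (J : Event → FourVec ℂ) : Event → FourVec ℂ :=
  retarded C μ₀ (inferred C u J)

/-- The Fourier transform
`F[φ](k, w) = (2 π)⁻² ∬ exp(-i (k · x - w t)) φ(x, t) d³x dt`. -/
def fourierT {F : Type} [NormedAddCommGroup F] [NormedSpace ℂ F]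
    (φ : Event → F) (p : Event) : F :=
  (((2 * Real.pi) ^ 2)⁻¹ : ℝ) •
    ∫ X : Event, Complex.exp (-Complex.I * ((inner ℝ p.1 X.1 - p.2 * X.2 : ℝ) : ℂ)) • φ X

/-- The Fourier spectrum of a bounded continuous field `A`, as a tempered distribution in the
variables `(k, w)`: `⟨F[A], g⟩ = ∬ A(x, t) F[g](x, t) d³x dt`. -/
def spectrum (A : Event → FourVec ℂ) (g : Event → ℂ) : FourVec ℂ :=
  ∫ X : Event, fourierT g X • A X

/-- Smooth complex test functions whose support is a compact subset of `Ω`. -/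
def IsTest (Ω : Set Event) (g : Event → ℂ) : Prop :=
  ContDiff ℝ ∞ g ∧ HasCompactSupport g ∧ tsupport g ⊆ Ω

/-- The support of a distribution: the points none of whose neighbourhoods is free of test
functions on which it does not vanish. -/
def distSupport (T : (Event → ℂ) → FourVec ℂ) : Set Event :=
  {p | ∀ U ∈ nhds p, ∃ g, IsTest U g ∧ T g ≠ 0}

/-- The family `T i` of distributions does not fade out at `p` along `l`: arbitrarily close to
`p` there is a test function on which it stays bounded away from zero. -/
def PersistsAt {ι : Type} (l : Filter ι) (T : ι → (Event → ℂ) → FourVec ℂ) (p : Event) : Prop :=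
  ∀ U ∈ nhds p, ∃ g, IsTest U g ∧ ∃ δ > 0, ∀ᶠ i in l, δ ≤ ‖T i g‖

/-- The family `T i` of spectra develops, along `l`, a sharp peak at `p`, which is its only one
in the spectral window `Ω`: it does not fade out at `p`, and it tends to zero on `Ω` away from
`p`, in the sense of distributions. -/
def SpectrumPeaksAt {ι : Type} (l : Filter ι) (T : ι → (Event → ℂ) → FourVec ℂ)
    (Ω : Set Event) (p : Event) : Prop :=
  p ∈ Ω ∧ PersistsAt l T p ∧
    ∀ g, IsTest (Ω \ {p}) g → Filter.Tendsto (fun i => T i g) l (nhds 0)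

/-- The current-charges `J i`, rapidly decreasing in space and time, emit waves with wave data
`p = (k, w)` (the only ones in the spectral window `Ω`) that are more and more monochromatic
along `l`: the spectrum of `J i` does not fade out at `p`, and it tends to zero on `Ω` away from
`p` together with all its derivatives, locally uniformly. An example is given by wave trains
`χ(x / R, t / R) exp(i (k · x - w t)) a`, `χ(0, 0) ≠ 0`, `a ≠ 0`, of length `R → ∞`. -/
def EmitsWaves {ι : Type} (l : Filter ι) (J : ι → SchwartzMap Event (FourVec ℂ))
    (Ω : Set Event) (p : Event) : Prop :=
  p ∈ Ω ∧ PersistsAt l (fun i g => ∫ q : Event, g q • fourierT (J i) q) p ∧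
    ∀ m : ℕ, TendstoLocallyUniformlyOn
      (fun i q => iteratedFDeriv ℝ m (fourierT (J i)) q) 0 l (Ω \ {p})

end Doppler

end

/-!
The retarded potentials are the convolution of the current-charge with a multiple of the measure
`ν = d³z / |z|` on the forward light cone (`lightCone`, `retarded_eq`), and all assertions follow
from two properties of `ν`.

*Lorentz invariance* (`map_boostEvent_lightCone`). A boost acts on the cone, parametrised by space,
through a map whose derivative is a product of two transvections; its Jacobian is the quotient
of the weights (`det_coneMapDeriv`). Hence the perceived potentials are the boosted potentials of
the source at rest (`perceived_eq`). As boosts of wave data and of events preserve the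
volume and the phase of plane waves, the spectra transform accordingly (`spectrum_perceived`), and
everything is reduced to a source at rest.

*The wave equation* (`integral_dAlembert_lightCone`): `∫ (∂ₜ² - C² Δ) f dν = 4 π C² f(0)` for
Schwartz functions `f`. The cone is replaced by the hyperboloid `C t = √(|z|² + ε²)`, over which
the integrand is the divergence of the smooth field `waveField` up to terms that vanish with `ε` and
an approximate Dirac mass.

By the convolution theorem (`spectrum_retarded`) the pairing of the spectrum of the potentials with
a test function `g` is a multiple of `∫ F[g F[J]] dν`, a continuous functional of `g F[J]`. This
gives the bound for the spectral support from above and the vanishing of the spectra off the peak.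
The wave equation says that multiplication by the symbol `C² |k|² - w²` turns the spectrum
of the potentials into `μ₀ C² F[J]` (`spectrum_retarded_symbol_mul`). It gives the formula off the
light cone, where the symbol can be divided out, the bound for the support from below, and the
persistence of the peak: a test function `g` that detects the source gives
`(C² |k|² - w²) g`, which detects the potentials. The last argument is insensitive to whether the
wave data lie on the light cone.
-/

noncomputable section

namespace Doppler

open MeasureTheory Filter Topology LineDeriv SchwartzMap FourierTransform

/-! ### Lorentz boosts -/

section Algebra

variable {C : ℝ} {u : Space}

lemma one_sub_sq_pos (hC : 0 < C) (hu : ‖u‖ < C) : 0 < 1 - ‖u‖ ^ 2 / C ^ 2 := by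
  have : ‖u‖ ^ 2 < C ^ 2 := by gcongr
  rw [sub_pos, div_lt_one (by positivity)]
  exact this

lemma gam_pos (hC : 0 < C) (hu : ‖u‖ < C) : 0 < gam C u := by
  have := one_sub_sq_pos hC hu
  unfold gam
  positivity

lemma gam_sq_mul (hC : 0 < C) (hu : ‖u‖ < C) : gam C u ^ 2 * (C ^ 2 - ‖u‖ ^ 2) = C ^ 2 := by
  have h := one_sub_sq_pos hC hu
  have h2 : C ^ 2 - ‖u‖ ^ 2 ≠ 0 := by
    intro h0
    have : 1 - ‖u‖ ^ 2 / C ^ 2 = (C ^ 2 - ‖u‖ ^ 2) / C ^ 2 := by field_simp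
    rw [this, h0] at h
    simp at h
  unfold gam
  rw [div_pow, Real.sq_sqrt h.le]
  field_simp

@[simp] lemma gam_neg : gam C (-u) = gam C u := by simp [gam]

lemma gam_zero : gam C 0 = 1 := by simp [gam]

/-- The coefficient `γ² / (C² (1 + γ))`, which equals `(γ - 1) / |u|²` for `u ≠ 0` and makes
sense for `u = 0` as well. -/
def boostCoeff (C : ℝ) (u : Space) : ℝ := gam C u ^ 2 / (C ^ 2 * (1 + gam C u))

@[simp] lemma boostCoeff_neg : boostCoeff C (-u) = boostCoeff C u := by simp [boostCoeff]

lemma boostCoeff_mul_sq (hC : 0 < C) (hu : ‖u‖ < C) :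
    boostCoeff C u * ‖u‖ ^ 2 = gam C u - 1 := by
  have h1 := gam_pos hC hu
  have h2 := gam_sq_mul hC hu
  unfold boostCoeff
  field_simp
  linarith

lemma boostCoeff_mul_add (hC : 0 < C) (hu : ‖u‖ < C) :
    boostCoeff C u * (1 + gam C u) = gam C u ^ 2 / C ^ 2 := by
  have h1 := gam_pos hC hu
  unfold boostCoeff
  field_simp

variable {𝕜 : Type} [RCLike 𝕜]

lemma dot_neg_left (z : EuclideanSpace 𝕜 (Fin 3)) : dot (-u) z = -dot u z := by
  simp [dot]

lemma dot_add_right (y z : EuclideanSpace 𝕜 (Fin 3)) : dot u (y + z) = dot u y + dot u z := by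
  simp [dot, mul_add, Finset.sum_add_distrib]

lemma dot_smul_right (c : 𝕜) (z : EuclideanSpace 𝕜 (Fin 3)) : dot u (c • z) = c * dot u z := by
  simp only [dot, PiLp.smul_apply, smul_eq_mul, Finset.mul_sum]
  exact Finset.sum_congr rfl fun i _ => by ring

lemma castVec_neg : castVec 𝕜 (-u) = -castVec 𝕜 u := by
  ext i; simp [castVec]

lemma dot_castVec_self : dot u (castVec 𝕜 u) = ((‖u‖ ^ 2 : ℝ) : 𝕜) := by
  rw [EuclideanSpace.real_norm_sq_eq]
  simp [dot, castVec, sq]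

lemma dot_real (a z : Space) : dot (𝕜 := ℝ) a z = inner ℝ a z := by
  simp [dot, PiLp.inner_apply, mul_comm]

lemma castVec_real (a : Space) : castVec ℝ a = a := by
  ext i; simp [castVec]

/-- The boost without unit vectors. -/
lemma lorentz_eq (hC : 0 < C) (hu : ‖u‖ < C) (Z : FourVec 𝕜) :
    lorentz C u Z =
      (Z.1 + ((boostCoeff C u : 𝕜) * dot u Z.1 + ((gam C u / C : ℝ) : 𝕜) * Z.2) • castVec 𝕜 u,
        (gam C u : 𝕜) * (Z.2 + dot u Z.1 / (C : 𝕜))) := by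
  have h1 : dot (unitVec u) Z.1 = ((‖u‖⁻¹ : ℝ) : 𝕜) * dot u Z.1 := by
    simp only [dot, unitVec, PiLp.smul_apply, smul_eq_mul, Finset.mul_sum, RCLike.ofReal_mul]
    exact Finset.sum_congr rfl fun i _ => by ring
  have h2 : castVec 𝕜 (unitVec u) = ((‖u‖⁻¹ : ℝ) : 𝕜) • castVec 𝕜 u := by
    ext i; simp [castVec, unitVec]
  have h3 : (((gam C u - 1 : ℝ) : 𝕜) * (((‖u‖⁻¹ : ℝ) : 𝕜) * dot u Z.1)) •
      ((‖u‖⁻¹ : ℝ) : 𝕜) • castVec 𝕜 u = ((boostCoeff C u : 𝕜) * dot u Z.1) • castVec 𝕜 u := by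
    rcases eq_or_ne u 0 with rfl | hu0
    · have : castVec 𝕜 (0 : Space) = 0 := by ext i; simp [castVec]
      simp [this]
    · rw [smul_smul, ← boostCoeff_mul_sq hC hu]
      congr 1
      have : ‖u‖ ≠ 0 := norm_ne_zero_iff.2 hu0
      have h4 : ((‖u‖ : ℝ) : 𝕜) ≠ 0 := by exact_mod_cast this
      push_cast
      field_simp
  unfold lorentz
  rw [h1, h2, h3, add_smul, add_assoc]

/-- The boosts with velocities `u` and `-u` are inverse to each other. This needs only the three
relations `β |u|² = γ - 1`, `β (1 + γ) = γ² / C²` and `γ² (C² - |u|²) = C²` for the coefficient `β`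
of `lorentz_eq`. -/
lemma lorentz_neg_lorentz (hC : 0 < C) (hu : ‖u‖ < C) (Z : FourVec 𝕜) :
    lorentz C (-u) (lorentz C u Z) = Z := by
  have hu' : ‖-u‖ < C := by rwa [norm_neg]
  have hC' : (C : 𝕜) ≠ 0 := by exact_mod_cast hC.ne'
  have e1 : (boostCoeff C u : 𝕜) * ((‖u‖ ^ 2 : ℝ) : 𝕜) = gam C u - 1 := by
    exact_mod_cast congrArg (fun x : ℝ => (x : 𝕜)) (boostCoeff_mul_sq hC hu)
  have e2 : (boostCoeff C u : 𝕜) * (1 + gam C u) = gam C u ^ 2 / C ^ 2 := by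
    exact_mod_cast congrArg (fun x : ℝ => (x : 𝕜)) (boostCoeff_mul_add hC hu)
  have e3 : (gam C u : 𝕜) ^ 2 * (C ^ 2 - ((‖u‖ ^ 2 : ℝ) : 𝕜)) = C ^ 2 := by
    exact_mod_cast congrArg (fun x : ℝ => (x : 𝕜)) (gam_sq_mul hC hu)
  rw [lorentz_eq hC hu, lorentz_eq hC hu']
  simp only [gam_neg, boostCoeff_neg, dot_neg_left, castVec_neg, dot_add_right, dot_smul_right,
    dot_castVec_self]
  set a := dot u Z.1
  set q := ((‖u‖ ^ 2 : ℝ) : 𝕜)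
  set b := (boostCoeff C u : 𝕜)
  set g := (gam C u : 𝕜)
  have e2' : b * (1 + g) * C ^ 2 = g ^ 2 := by rw [e2]; field_simp
  refine Prod.ext ?_ ?_
  · simp only [smul_neg]
    rw [add_assoc, ← sub_eq_add_neg, ← sub_smul]
    convert add_zero Z.1
    convert zero_smul 𝕜 (castVec 𝕜 u)
    push_cast
    field_simp
    linear_combination (a * C ^ 2 * b + C * Z.2 * g) * e1 + a * e2'
  · push_cast
    field_simp
    linear_combination Z.2 * e3 - a * g * C * e1

lemma lorentz_lorentz_neg (hC : 0 < C) (hu : ‖u‖ < C) (Z : FourVec 𝕜) :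
    lorentz C u (lorentz C (-u) Z) = Z := by
  have := lorentz_neg_lorentz (u := -u) hC (by rwa [norm_neg]) Z
  rwa [neg_neg] at this

lemma lorentz_zero (Z : FourVec 𝕜) : lorentz C 0 Z = Z := by
  have h : castVec 𝕜 (0 : Space) = 0 := by ext i; simp [castVec]
  have h' : dot (0 : Space) Z.1 = 0 := by simp [dot]
  simp [lorentz, h, h', unitVec, gam_zero]

lemma lorentz_add (Y Z : FourVec 𝕜) : lorentz C u (Y + Z) = lorentz C u Y + lorentz C u Z := by
  refine Prod.ext ?_ ?_
  · simp only [lorentz, Prod.fst_add, Prod.snd_add, dot_add_right]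
    module
  · simp only [lorentz, Prod.fst_add, Prod.snd_add, dot_add_right]
    ring

lemma lorentz_smul (c : 𝕜) (Z : FourVec 𝕜) : lorentz C u (c • Z) = c • lorentz C u Z := by
  refine Prod.ext ?_ ?_
  · simp only [lorentz, Prod.smul_fst, Prod.smul_snd, dot_smul_right, smul_eq_mul]
    module
  · simp only [lorentz, Prod.smul_fst, Prod.smul_snd, dot_smul_right, smul_eq_mul]
    ring

/-- The Lorentz boost as a continuous linear automorphism of the four-vectors. -/
def lorentzEquiv (𝕜 : Type) [RCLike 𝕜] (hC : 0 < C) (hu : ‖u‖ < C) :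
    FourVec 𝕜 ≃L[𝕜] FourVec 𝕜 :=
  LinearEquiv.toContinuousLinearEquiv
    { toFun := lorentz C u
      map_add' := lorentz_add
      map_smul' := lorentz_smul
      invFun := lorentz C (-u)
      left_inv := lorentz_neg_lorentz hC hu
      right_inv := lorentz_lorentz_neg hC hu }

@[simp] lemma lorentzEquiv_apply (hC : 0 < C) (hu : ‖u‖ < C) (Z : FourVec 𝕜) :
    lorentzEquiv 𝕜 hC hu Z = lorentz C u Z := rfl

/-- Boosts preserve the Minkowski form. -/
lemma minkowski_lorentz (hC : 0 < C) (hu : ‖u‖ < C) (Y Z : FourVec ℝ) :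
    inner ℝ (lorentz C u Y).1 (lorentz C u Z).1 - (lorentz C u Y).2 * (lorentz C u Z).2 =
      inner ℝ Y.1 Z.1 - Y.2 * Z.2 := by
  have e1 := boostCoeff_mul_sq hC hu
  have e2 := boostCoeff_mul_add hC hu
  have e3 := gam_sq_mul hC hu
  rw [lorentz_eq hC hu, lorentz_eq hC hu]
  simp only [dot_real, castVec_real, inner_add_left, inner_add_right, real_inner_smul_left,
    real_inner_smul_right, real_inner_self_eq_norm_sq, RCLike.ofReal_real_eq_id, id_eq]
  rw [real_inner_comm u Y.1]
  set a := inner ℝ u Y.1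
  set b := inner ℝ u Z.1
  set q := ‖u‖ ^ 2
  set β := boostCoeff C u
  set g := gam C u
  have e2' : β * (1 + g) * C ^ 2 = g ^ 2 := by rw [e2]; field_simp
  field_simp
  linear_combination (a * b * β * C ^ 2 + (a * Z.2 + b * Y.2) * C * g) * e1 + a * b * e2'
    - Y.2 * Z.2 * e3

/-- Rescaling the time coordinate by `C`. -/
def timeScale (hC : 0 < C) : Event ≃L[ℝ] Event :=
  (ContinuousLinearEquiv.refl ℝ Space).prodCongr
    (ContinuousLinearEquiv.smulLeft (Units.mk0 C hC.ne'))

/-- The boost of events as a continuous linear automorphism. -/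
def boostEventEquiv (hC : 0 < C) (hu : ‖u‖ < C) : Event ≃L[ℝ] Event :=
  ((timeScale hC).trans (lorentzEquiv ℝ hC hu)).trans (timeScale hC).symm

/-- The boost of wave data as a continuous linear automorphism. -/
def boostWaveEquiv (hC : 0 < C) (hu : ‖u‖ < C) : Event ≃L[ℝ] Event :=
  ((timeScale hC).symm.trans (lorentzEquiv ℝ hC hu)).trans (timeScale hC)

lemma timeScale_apply (hC : 0 < C) (X : Event) : timeScale hC X = (X.1, C * X.2) := rfl

lemma timeScale_symm_apply (hC : 0 < C) (X : Event) : (timeScale hC).symm X = (X.1, X.2 / C) := by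
  rw [ContinuousLinearEquiv.symm_apply_eq, timeScale_apply]
  ext <;> simp; field_simp

lemma boostEventEquiv_apply (hC : 0 < C) (hu : ‖u‖ < C) (X : Event) :
    boostEventEquiv hC hu X = boostEvent C u X := by
  simp only [boostEventEquiv, ContinuousLinearEquiv.trans_apply, timeScale_apply,
    timeScale_symm_apply, lorentzEquiv_apply]
  rfl

lemma boostWaveEquiv_apply (hC : 0 < C) (hu : ‖u‖ < C) (X : Event) :
    boostWaveEquiv hC hu X = boostWave C u X := by
  simp only [boostWaveEquiv, ContinuousLinearEquiv.trans_apply, timeScale_apply,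
    timeScale_symm_apply, lorentzEquiv_apply]
  rfl

lemma boostEventEquiv_symm_apply (hC : 0 < C) (hu : ‖u‖ < C) (X : Event) :
    (boostEventEquiv hC hu).symm X = boostEvent C (-u) X := by
  rw [← boostEventEquiv_apply hC (by rwa [norm_neg])]
  rfl

lemma boostWaveEquiv_symm_apply (hC : 0 < C) (hu : ‖u‖ < C) (X : Event) :
    (boostWaveEquiv hC hu).symm X = boostWave C (-u) X := by
  rw [← boostWaveEquiv_apply hC (by rwa [norm_neg])]
  rfl

lemma boostWave_neg_boostWave (hC : 0 < C) (hu : ‖u‖ < C) (p : Event) :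
    boostWave C (-u) (boostWave C u p) = p := by
  rw [← boostWaveEquiv_symm_apply hC hu, ← boostWaveEquiv_apply hC hu,
    ContinuousLinearEquiv.symm_apply_apply]

lemma boostWave_boostWave_neg (hC : 0 < C) (hu : ‖u‖ < C) (p : Event) :
    boostWave C u (boostWave C (-u) p) = p := by
  rw [← boostWaveEquiv_symm_apply hC hu, ← boostWaveEquiv_apply hC hu,
    ContinuousLinearEquiv.apply_symm_apply]

lemma continuous_boostWave (hC : 0 < C) (hu : ‖u‖ < C) : Continuous (boostWave C u) :=
  (boostWaveEquiv hC hu).continuous.congr (boostWaveEquiv_apply hC hu)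

/-- The phase `k · x - w t` of a plane wave with wave data `p = (k, w)` at the event
`X = (x, t)`. -/
def phase (p X : Event) : ℝ := inner ℝ p.1 X.1 - p.2 * X.2

/-- The phase of a plane wave is a Lorentz scalar. -/
lemma phase_boost (hC : 0 < C) (hu : ‖u‖ < C) (p X : Event) :
    phase (boostWave C u p) (boostEvent C u X) = phase p X := by
  have := minkowski_lorentz hC hu (p.1, p.2 / C) (X.1, C * X.2)
  simp only [phase, boostWave, boostEvent]
  have e : p.2 / C * (C * X.2) = p.2 * X.2 := by field_simp
  rw [← e, ← this]
  field_simp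

/-- The boosts preserve the wave operator's symbol `C² |k|² - w²`. -/
lemma symbol_boostWave (hC : 0 < C) (hu : ‖u‖ < C) (p : Event) :
    C ^ 2 * ‖(boostWave C u p).1‖ ^ 2 - (boostWave C u p).2 ^ 2 =
      C ^ 2 * ‖p.1‖ ^ 2 - p.2 ^ 2 := by
  have := minkowski_lorentz hC hu (p.1, p.2 / C) (p.1, p.2 / C)
  simp only [real_inner_self_eq_norm_sq] at this
  simp only [boostWave]
  have e : C ^ 2 * (p.2 / C * (p.2 / C)) = p.2 ^ 2 := by field_simp
  linear_combination C ^ 2 * this - e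

instance : (volume : Measure Event).IsAddHaarMeasure :=
  Measure.prod.instIsAddHaarMeasure volume volume

/-- A linear automorphism conjugate to its inverse under a linear map preserves the volume,
since its determinant is `±1`. -/
lemma measurePreserving_of_conj_symm (A P : Event ≃L[ℝ] Event)
    (h : ∀ X, P (A (P.symm X)) = A.symm X) : MeasurePreserving A := by
  refine ⟨A.continuous.measurable, ?_⟩
  have h1 : (A : Event →ₗ[ℝ] Event).det * (A : Event →ₗ[ℝ] Event).det = 1 := by
    have h2 : ((P : Event ≃ₗ[ℝ] Event) : Event →ₗ[ℝ] Event) ∘ₗ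
        ((A : Event ≃ₗ[ℝ] Event) : Event →ₗ[ℝ] Event) ∘ₗ
        ((P : Event ≃ₗ[ℝ] Event).symm : Event →ₗ[ℝ] Event) =
        ((A : Event ≃ₗ[ℝ] Event).symm : Event →ₗ[ℝ] Event) := by
      ext1 <;> ext1 <;> exact h _
    have h3 := LinearMap.det_conj ((A : Event ≃ₗ[ℝ] Event) : Event →ₗ[ℝ] Event)
      (P : Event ≃ₗ[ℝ] Event)
    rw [h2] at h3
    have h4 := LinearEquiv.det_mul_det_symm (A : Event ≃ₗ[ℝ] Event)
    rw [h3] at h4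
    exact h4
  have h2 : |(A : Event →ₗ[ℝ] Event).det| = 1 := by
    rcases mul_self_eq_one_iff.1 h1 with h | h <;> rw [h] <;> simp
  have h3 : (A : Event →ₗ[ℝ] Event).det ≠ 0 := fun h0 => by simp [h0] at h1
  have := Measure.map_linearMap_addHaar_eq_smul_addHaar (volume : Measure Event) h3
  rw [abs_inv, h2] at this
  simpa using this

/-- The reflection of space. -/
def parity : Event ≃L[ℝ] Event :=
  (ContinuousLinearEquiv.neg ℝ).prodCongr (ContinuousLinearEquiv.refl ℝ ℝ)

lemma parity_lorentz (Z : FourVec ℝ) :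
    parity (lorentz C u (parity Z)) = lorentz C (-u) Z := by
  have h1 : ∀ a : Space, castVec ℝ a = a := castVec_real
  have h2 : unitVec (-u) = - unitVec u := by simp [unitVec]
  ext <;> simp [parity, lorentz, h2, h1, dot_real]
  ring

lemma parity_symm_apply (X : Event) : parity.symm X = parity X := rfl

lemma parity_timeScale (hC : 0 < C) (X : Event) :
    parity (timeScale hC X) = timeScale hC (parity X) := rfl

lemma parity_timeScale_symm (hC : 0 < C) (X : Event) :
    parity ((timeScale hC).symm X) = (timeScale hC).symm (parity X) := rfl

lemma measurePreserving_boostEvent (hC : 0 < C) (hu : ‖u‖ < C) :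
    MeasurePreserving (boostEventEquiv hC hu) := by
  refine measurePreserving_of_conj_symm _ parity fun X => ?_
  have := parity_lorentz (C := C) (u := u) (timeScale hC X)
  simp only [boostEventEquiv, ContinuousLinearEquiv.trans_apply, lorentzEquiv_apply,
    parity_symm_apply, ← parity_timeScale]
  rw [parity_timeScale_symm, this]
  rfl

lemma measurePreserving_boostWave (hC : 0 < C) (hu : ‖u‖ < C) :
    MeasurePreserving (boostWaveEquiv hC hu) := by
  refine measurePreserving_of_conj_symm _ parity fun X => ?_
  have := parity_lorentz (C := C) (u := u) ((timeScale hC).symm X)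
  simp only [boostWaveEquiv, ContinuousLinearEquiv.trans_apply, lorentzEquiv_apply,
    parity_symm_apply, ← parity_timeScale_symm]
  rw [parity_timeScale, this]
  rfl

end Algebra

/-! ### The measure on the forward light cone -/

section Cone

variable {C : ℝ} {u : Space}

/-- In three dimensions the weights `|z|⁻¹` and `|z|⁻²` are integrable against rapidly
decreasing functions. -/
lemma integrable_inv_norm_pow {m : ℕ} (hm : m ≤ 2) :
    Integrable fun z : Space => (‖z‖ ^ m)⁻¹ * ((1 + ‖z‖) ^ 4)⁻¹ := by
  rw [integrable_fun_norm_addHaar volume (f := fun y => (y ^ m)⁻¹ * ((1 + y) ^ 4)⁻¹)]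
  simp only [finrank_euclideanSpace, Fintype.card_fin, Nat.add_one_sub_one, smul_eq_mul]
  refine (integrable_inv_one_add_sq.integrableOn (s := Set.Ioi 0)).mono'
    (by fun_prop) ?_
  refine (ae_restrict_iff' measurableSet_Ioi).2 (Filter.Eventually.of_forall fun y hy => ?_)
  have hy : 0 < y := hy
  rw [Real.norm_of_nonneg (by positivity)]
  have h1 : y ^ 2 * (y ^ m)⁻¹ = y ^ (2 - m) := by
    rw [← pow_sub₀ y hy.ne' hm]
  have h2 : y ^ (2 - m) ≤ (1 + y) ^ 2 := by
    calc y ^ (2 - m) ≤ (1 + y) ^ (2 - m) := by gcongr; linarith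
      _ ≤ (1 + y) ^ 2 := pow_le_pow_right₀ (by linarith) (by omega)
  rw [← mul_assoc, h1]
  calc y ^ (2 - m) * ((1 + y) ^ 4)⁻¹ ≤ (1 + y) ^ 2 * ((1 + y) ^ 4)⁻¹ := by gcongr
    _ = ((1 + y) ^ 2)⁻¹ := by field_simp
    _ ≤ (1 + y ^ 2)⁻¹ := by
        apply inv_anti₀ (by positivity)
        nlinarith

/-- The point of the forward light cone over `z`. -/
def conePoint (C : ℝ) (z : Space) : Event := (z, ‖z‖ / C)

lemma continuous_conePoint : Continuous (conePoint C) := by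
  unfold conePoint; fun_prop

lemma measurableEmbedding_conePoint : MeasurableEmbedding (conePoint C) :=
  continuous_conePoint.measurableEmbedding fun _ _ h => congrArg Prod.fst h

/-- The measure `d³z / |z|` on the forward light cone: up to a factor, the retarded fundamental
solution of the wave equation. -/
def lightCone (C : ℝ) : Measure Event :=
  ((volume : Measure Space).withDensity fun z => ENNReal.ofReal ‖z‖⁻¹).map (conePoint C)

instance : SFinite (lightCone C) := by unfold lightCone; infer_instance

variable {E : Type*} [NormedAddCommGroup E] [NormedSpace ℝ E]

lemma integrable_lightCone_iff {f : Event → E} :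
    Integrable f (lightCone C) ↔ Integrable fun z : Space => ‖z‖⁻¹ • f (conePoint C z) := by
  rw [lightCone, measurableEmbedding_conePoint.integrable_map_iff,
    integrable_withDensity_iff_integrable_smul' (by fun_prop) (by simp)]
  simp only [ENNReal.toReal_ofReal (inv_nonneg.2 (norm_nonneg _)), Function.comp]

lemma integral_lightCone (f : Event → E) :
    ∫ Y, f Y ∂lightCone C = ∫ z : Space, ‖z‖⁻¹ • f (conePoint C z) := by
  rw [lightCone, measurableEmbedding_conePoint.integral_map,
    integral_withDensity_eq_integral_toReal_smul (by fun_prop) (by simp)]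
  simp only [ENNReal.toReal_ofReal (inv_nonneg.2 (norm_nonneg _))]

lemma integrable_lightCone_pow : Integrable (fun Y => ((1 + ‖Y‖) ^ 4)⁻¹) (lightCone C) := by
  rw [integrable_lightCone_iff]
  have := integrable_inv_norm_pow (m := 1) (by norm_num)
  refine this.mono' (by unfold conePoint; fun_prop) (Filter.Eventually.of_forall fun z => ?_)
  rw [smul_eq_mul, Real.norm_of_nonneg (by positivity), pow_one]
  have : ‖z‖ ≤ ‖conePoint C z‖ := norm_fst_le (conePoint C z)
  gcongr

instance : (lightCone C).HasTemperateGrowth where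
  exists_integrable := ⟨4, by
    refine integrable_lightCone_pow.congr (Filter.Eventually.of_forall fun Y => ?_)
    simp only [Nat.cast_ofNat]
    rw [Real.rpow_neg (by positivity)]
    norm_cast⟩

/-! ### Lorentz invariance of the cone measure -/

/-- The action of a boost on the forward light cone, parametrised by space. -/
def coneMap (C : ℝ) (u : Space) (z : Space) : Space := (boostEvent C u (conePoint C z)).1

lemma coneMap_eq (hC : 0 < C) (hu : ‖u‖ < C) (z : Space) :
    coneMap C u z = z + (boostCoeff C u * inner ℝ u z + gam C u / C * ‖z‖) • u := by
  simp only [coneMap, boostEvent, lorentz_eq hC hu, conePoint, dot_real, castVec_real,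
    RCLike.ofReal_real_eq_id, id_eq]
  congr 3
  field_simp

/-- Boosts map the forward light cone into itself. -/
lemma norm_coneMap (hC : 0 < C) (hu : ‖u‖ < C) (z : Space) :
    ‖coneMap C u z‖ = gam C u * (‖z‖ + inner ℝ u z / C) := by
  have h := minkowski_lorentz hC hu (z, ‖z‖) (z, ‖z‖)
  have e : C * (‖z‖ / C) = ‖z‖ := by field_simp
  have h1 : (lorentz (𝕜 := ℝ) C u (z, ‖z‖)).1 = coneMap C u z := by
    simp only [coneMap, boostEvent, conePoint, e]
  have h2 : (lorentz (𝕜 := ℝ) C u (z, ‖z‖)).2 = gam C u * (‖z‖ + inner ℝ u z / C) := by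
    simp [lorentz, dot_real]
  rw [h1, h2] at h
  simp only [real_inner_self_eq_norm_sq] at h
  have h3 : 0 ≤ ‖z‖ + inner ℝ u z / C := by
    have := abs_le.1 (abs_real_inner_le_norm u z)
    have h4 : ‖u‖ * ‖z‖ ≤ C * ‖z‖ := by gcongr
    have : -‖z‖ ≤ inner ℝ u z / C := by
      rw [le_div_iff₀ hC]; linarith
    linarith
  have := gam_pos hC hu
  refine (sq_eq_sq₀ (norm_nonneg _) (by positivity)).1 ?_
  linarith

lemma boostEvent_conePoint (hC : 0 < C) (hu : ‖u‖ < C) (z : Space) :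
    boostEvent C u (conePoint C z) = conePoint C (coneMap C u z) := by
  refine Prod.ext rfl ?_
  simp only [conePoint, norm_coneMap hC hu, boostEvent, lorentz_eq hC hu, dot_real,
    RCLike.ofReal_real_eq_id, id_eq]
  field_simp

lemma coneMap_neg_coneMap (hC : 0 < C) (hu : ‖u‖ < C) (z : Space) :
    coneMap C (-u) (coneMap C u z) = z := by
  rw [coneMap, ← boostEvent_conePoint hC hu, ← boostEventEquiv_symm_apply hC hu,
    ← boostEventEquiv_apply hC hu, ContinuousLinearEquiv.symm_apply_apply]
  rfl

lemma coneMap_ne_zero (hC : 0 < C) (hu : ‖u‖ < C) {z : Space} (hz : z ≠ 0) :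
    coneMap C u z ≠ 0 := by
  intro h
  apply hz
  rw [← coneMap_neg_coneMap hC hu z, h, coneMap_eq hC (by rwa [norm_neg])]
  simp

/-- The derivative of `coneMap`, a composition of two transvections. -/
def coneMapDeriv (C : ℝ) (u z : Space) : Space →L[ℝ] Space :=
  (LinearMap.transvection (boostCoeff C u • (innerₛₗ ℝ u)) u ∘ₗ
    LinearMap.transvection (‖z‖⁻¹ • (innerₛₗ ℝ z)) (C⁻¹ • u)).toContinuousLinearMap

/-- The Jacobian of `coneMap` is the ratio of the two weights, so that `d³z / |z|` is invariant. -/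
lemma det_coneMapDeriv (hC : 0 < C) (hu : ‖u‖ < C) {z : Space} (hz : z ≠ 0) :
    (coneMapDeriv C u z).det = ‖coneMap C u z‖ * ‖z‖⁻¹ := by
  have hz' := norm_ne_zero_iff.2 hz
  have h : (coneMapDeriv C u z).det = (1 + boostCoeff C u * ‖u‖ ^ 2) *
      (1 + ‖z‖⁻¹ * (C⁻¹ * inner ℝ z u)) := by
    unfold coneMapDeriv ContinuousLinearMap.det
    rw [LinearMap.coe_toContinuousLinearMap, LinearMap.det_comp, LinearMap.transvection.det,
      LinearMap.transvection.det]
    simp only [LinearMap.smul_apply, innerₛₗ_apply_apply, real_inner_smul_right,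
      real_inner_self_eq_norm_sq, smul_eq_mul]
  rw [h, boostCoeff_mul_sq hC hu, norm_coneMap hC hu, real_inner_comm]
  field_simp
  ring

lemma hasFDerivAt_coneMap (hC : 0 < C) (hu : ‖u‖ < C) {z : Space} (hz : z ≠ 0) :
    HasFDerivAt (coneMap C u) (coneMapDeriv C u z) z := by
  have hz' := norm_ne_zero_iff.2 hz
  have h0 : coneMap C u =
      fun z => z + (boostCoeff C u * inner ℝ u z + gam C u / C * ‖z‖) • u :=
    funext fun z => coneMap_eq hC hu z
  -- the norm, as the square root of its smooth square
  have h1 : HasFDerivAt (fun z : Space => ‖z‖) (‖z‖⁻¹ • innerSL ℝ z) z := by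
    have h2 := ((hasStrictFDerivAt_norm_sq z).hasFDerivAt).sqrt (by positivity)
    simp only [Real.sqrt_sq (norm_nonneg _)] at h2
    refine h2.congr_fderiv ?_
    ext v
    simp
    field_simp
  have h2 := (hasFDerivAt_id z).add
    (((((innerSL ℝ u).hasFDerivAt (x := z)).const_mul (boostCoeff C u)).add
      (h1.const_mul (gam C u / C))).smul_const u)
  rw [h0]
  refine (h2.congr_fderiv ?_)
  have hg := boostCoeff_mul_sq hC hu
  ext1 v
  simp only [coneMapDeriv, LinearMap.transvection.apply, LinearMap.coe_toContinuousLinearMap',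
    LinearMap.comp_apply, LinearMap.smul_apply, innerₛₗ_apply_apply, smul_eq_mul,
    add_apply, smul_apply, innerSL_apply_apply,
    ContinuousLinearMap.smulRight_apply, ContinuousLinearMap.id_apply,
    inner_add_right, real_inner_smul_right, real_inner_self_eq_norm_sq]
  rw [smul_smul, add_assoc, ← add_smul]
  congr 2
  field_simp
  linear_combination (-inner ℝ z v) * hg

/-- The measure on the forward light cone is Lorentz invariant. -/
lemma map_boostEvent_lightCone (hC : 0 < C) (hu : ‖u‖ < C) :
    (lightCone C).map (boostEventEquiv hC hu) = lightCone C := by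
  have hmeas : Measurable (coneMap C u) := by
    have h0 : coneMap C u =
        fun z => z + (boostCoeff C u * inner ℝ u z + gam C u / C * ‖z‖) • u :=
      funext fun z => coneMap_eq hC hu z
    rw [h0]; fun_prop
  unfold lightCone
  rw [Measure.map_map (boostEventEquiv hC hu).continuous.measurable
    continuous_conePoint.measurable]
  have h1 : ⇑(boostEventEquiv hC hu) ∘ conePoint C = conePoint C ∘ coneMap C u := by
    ext1 z
    simp [boostEventEquiv_apply, boostEvent_conePoint hC hu]
  rw [h1, ← Measure.map_map continuous_conePoint.measurable hmeas]
  congr 1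
  have hinj : Set.InjOn (coneMap C u) {0}ᶜ :=
    (Function.LeftInverse.injective (coneMap_neg_coneMap hC hu)).injOn
  have himg : coneMap C u '' {0}ᶜ = {0}ᶜ := by
    refine Set.Subset.antisymm ?_ fun z hz => ?_
    · rintro _ ⟨z, hz, rfl⟩
      exact coneMap_ne_zero hC hu hz
    · refine ⟨coneMap C (-u) z, coneMap_ne_zero hC (by rwa [norm_neg]) hz, ?_⟩
      have := coneMap_neg_coneMap (u := -u) hC (by rwa [norm_neg]) z
      rwa [neg_neg] at this
  ext A hA
  rw [Measure.map_apply hmeas hA, withDensity_apply _ (hmeas hA), withDensity_apply _ hA,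
    ← lintegral_indicator hA, ← lintegral_indicator (hmeas hA)]
  -- `coneMap` is not differentiable at the origin, which is a null set
  have hae : ∀ f : Space → ENNReal, ∫⁻ z, f z = ∫⁻ z in ({0}ᶜ : Set Space), f z := fun f => by
    rw [restrict_compl_singleton]
  rw [hae, hae (A.indicator _)]
  conv_rhs => rw [← himg]
  rw [lintegral_image_eq_lintegral_abs_det_fderiv_mul volume
    (measurableSet_singleton (0 : Space)).compl
    (fun z hz => (hasFDerivAt_coneMap hC hu hz).hasFDerivWithinAt) hinj]
  refine setLIntegral_congr_fun (measurableSet_singleton (0 : Space)).compl fun z hz => ?_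
  have hz : z ≠ 0 := hz
  have hz2 := norm_ne_zero_iff.2 (coneMap_ne_zero hC hu hz)
  by_cases hA' : coneMap C u z ∈ A
  · rw [Set.indicator_of_mem hA', Set.indicator_of_mem (by exact hA'), det_coneMapDeriv hC hu hz,
      ← ENNReal.ofReal_mul (abs_nonneg _), abs_of_nonneg (by positivity)]
    congr 1
    field_simp
  · rw [Set.indicator_of_notMem hA', Set.indicator_of_notMem (by exact hA'), mul_zero]

end Cone

/-! ### The regularised wave equation on the light cone -/

section WaveEquation

variable {C : ℝ} {E : Type*} [NormedAddCommGroup E] [NormedSpace ℝ E]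

/-- Line derivatives of Schwartz functions commute. -/
lemma lineDerivOp_comm (v w : Event) (f : 𝓢(Event, E)) : ∂_{v} (∂_{w} f) = ∂_{w} (∂_{v} f) := by
  have hd : Differentiable ℝ (fderiv ℝ f) :=
    ((f.smooth 2).fderiv_right (m := 1) (by norm_num [one_add_one_eq_two])).differentiable (by simp)
  have key : ∀ (a b : Event) (X : Event),
      (∂_{a} (∂_{b} f)) X = fderiv ℝ (fderiv ℝ f) X a b := fun a b X => by
    rw [lineDerivOp_apply_eq_fderiv]
    have h1 : ⇑(∂_{b} f : 𝓢(Event, E)) = fun Y => fderiv ℝ f Y b :=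
      funext fun Y => lineDerivOp_apply_eq_fderiv b f Y
    rw [h1, fderiv_clm_apply (hd X) (differentiableAt_const _)]
    simp
  ext X
  rw [key, key]
  exact second_derivative_symmetric (f := f) (fun Y => f.hasFDerivAt Y) (hd X).hasFDerivAt v w

/-- A uniform decay estimate for Schwartz functions on the graph of a function over space. -/
lemma exists_norm_graph_le (g : 𝓢(Event, E)) :
    ∃ M, 0 ≤ M ∧ ∀ (z : Space) (t : ℝ), ‖g (z, t)‖ ≤ M * ((1 + ‖z‖) ^ 4)⁻¹ := by
  refine ⟨2 ^ 4 * (Finset.Iic (4, 0)).sup (fun m => SchwartzMap.seminorm ℝ m.1 m.2) g,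
    by positivity, fun z t => ?_⟩
  have h := one_add_le_sup_seminorm_apply (𝕜 := ℝ) (m := (4, 0)) le_rfl le_rfl g (z, t)
  rw [norm_iteratedFDeriv_zero] at h
  rw [← div_eq_mul_inv, le_div_iff₀ (by positivity), mul_comm]
  refine le_trans ?_ h
  have : ‖z‖ ≤ ‖((z, t) : Event)‖ := norm_fst_le (z, t)
  gcongr

lemma norm_smul_graph_le {a : Space → ℝ} {K : ℝ} {m : ℕ} {z : Space}
    (hK : |a z| ≤ K * (‖z‖ ^ m)⁻¹) {g : 𝓢(Event, E)} {M : ℝ}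
    (hM : ∀ (z : Space) (t : ℝ), ‖g (z, t)‖ ≤ M * ((1 + ‖z‖) ^ 4)⁻¹) (t : ℝ) :
    ‖a z • g (z, t)‖ ≤ K * M * ((‖z‖ ^ m)⁻¹ * ((1 + ‖z‖) ^ 4)⁻¹) := by
  rw [norm_smul, Real.norm_eq_abs]
  calc |a z| * ‖g (z, t)‖ ≤ (K * (‖z‖ ^ m)⁻¹) * (M * ((1 + ‖z‖) ^ 4)⁻¹) := by
        gcongr
        · exact (abs_nonneg _).trans hK
        · exact hM z t
    _ = _ := by ring

lemma ae_ne_zero : ∀ᵐ z : Space, z ≠ 0 := by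
  simp [ae_iff]

lemma integrable_smul_graph {a : Space → ℝ} (ha : Measurable a) {s : Space → ℝ}
    (hs : Continuous s) {K : ℝ} {m : ℕ} (hm : m ≤ 2)
    (hK : ∀ z, z ≠ 0 → |a z| ≤ K * (‖z‖ ^ m)⁻¹) (g : 𝓢(Event, E)) :
    Integrable fun z => a z • g (z, s z) := by
  obtain ⟨M, -, hM⟩ := exists_norm_graph_le g
  refine ((integrable_inv_norm_pow hm).const_mul (K * M)).mono' ?_ ?_
  · have : Continuous fun z => g (z, s z) := g.continuous.comp (by fun_prop)
    exact ha.aestronglyMeasurable.smul this.aestronglyMeasurable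
  · filter_upwards [ae_ne_zero] with z hz
    exact norm_smul_graph_le (hK z hz) hM _

/-- Dominated convergence for weighted integrals of a Schwartz function over the graphs of a
family of functions, with weights that may be as singular as `|z|⁻²` in the limit. -/
lemma tendsto_integral_smul_graph {a : ℝ → Space → ℝ} (ha : ∀ ε, Measurable (a ε))
    {s : ℝ → Space → ℝ} (hs : ∀ ε, Continuous (s ε)) {K : ℝ} {m : ℕ} (hm : m ≤ 2)
    (hK : ∀ ε > 0, ∀ z, z ≠ 0 → |a ε z| ≤ K * (‖z‖ ^ m)⁻¹) {a₀ s₀ : Space → ℝ}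
    (ha₀ : ∀ z, z ≠ 0 → Tendsto (fun ε => a ε z) (𝓝[>] 0) (𝓝 (a₀ z)))
    (hs₀ : ∀ z, z ≠ 0 → Tendsto (fun ε => s ε z) (𝓝[>] 0) (𝓝 (s₀ z))) (g : 𝓢(Event, E)) :
    Tendsto (fun ε => ∫ z, a ε z • g (z, s ε z)) (𝓝[>] 0)
      (𝓝 (∫ z, a₀ z • g (z, s₀ z))) := by
  obtain ⟨M, -, hM⟩ := exists_norm_graph_le g
  refine tendsto_integral_filter_of_dominated_convergence
    (fun z => K * M * ((‖z‖ ^ m)⁻¹ * ((1 + ‖z‖) ^ 4)⁻¹)) ?_ ?_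
    ((integrable_inv_norm_pow hm).const_mul (K * M)) ?_
  · refine Eventually.of_forall fun ε => ?_
    have : Continuous fun z => g (z, s ε z) :=
      g.continuous.comp (continuous_id.prodMk (hs ε))
    exact (ha ε).aestronglyMeasurable.smul this.aestronglyMeasurable
  · filter_upwards [self_mem_nhdsWithin] with ε hε
    filter_upwards [ae_ne_zero] with z hz
    exact norm_smul_graph_le (hK ε hε z hz) hM _
  · filter_upwards [ae_ne_zero] with z hz
    exact (ha₀ z hz).smul ((g.continuous.tendsto _).comp
      (tendsto_const_nhds.prodMk_nhds (hs₀ z hz)))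

/-- The integral of a directional derivative vanishes. -/
lemma integral_lineDeriv_eq_zero {F F' : Space → E} {v : Space}
    (hF : ∀ z, HasLineDerivAt ℝ F (F' z) z v) (hi : Integrable F) (hi' : Integrable F') :
    ∫ z, F' z = 0 := by
  have := integral_bilinear_hasLineDerivAt_right_eq_neg_left_of_integrable
    (μ := (volume : Measure Space)) (f := fun _ => (1 : ℝ)) (f' := fun _ => 0) (g := F) (g' := F')
    (v := v) (B := ContinuousLinearMap.lsmul ℝ ℝ) (by simp) (by simpa using hi')
    (by simpa using hi)
    (fun z _ => by simpa [HasLineDerivAt] using hasDerivAt_const (0 : ℝ) (1 : ℝ))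
    (fun z _ => hF z)
  simpa using this

/-- The smooth regularisation `√(|z|² + ε²)` of `|z|`. -/
def regNorm (ε : ℝ) (z : Space) : ℝ := √(‖z‖ ^ 2 + ε ^ 2)

lemma continuous_regNorm (ε : ℝ) : Continuous (regNorm ε) := by
  unfold regNorm; fun_prop

lemma regNorm_pos {ε : ℝ} (hε : 0 < ε) (z : Space) : 0 < regNorm ε z := by
  unfold regNorm; positivity

lemma regNorm_sq (ε : ℝ) (z : Space) : regNorm ε z ^ 2 = ‖z‖ ^ 2 + ε ^ 2 :=
  Real.sq_sqrt (by positivity)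

lemma norm_le_regNorm (ε : ℝ) (z : Space) : ‖z‖ ≤ regNorm ε z :=
  Real.le_sqrt_of_sq_le (by nlinarith [sq_nonneg ε])

lemma le_regNorm (ε : ℝ) (z : Space) : ε ≤ regNorm ε z :=
  Real.le_sqrt_of_sq_le (by nlinarith [sq_nonneg ‖z‖])

lemma abs_coord_le_regNorm (ε : ℝ) (z : Space) (j : Fin 3) : |z j| ≤ regNorm ε z :=
  (PiLp.norm_apply_le z j).trans (norm_le_regNorm ε z)

lemma tendsto_regNorm (z : Space) : Tendsto (fun ε => regNorm ε z) (𝓝[>] 0) (𝓝 ‖z‖) := by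
  have : Continuous fun ε => regNorm ε z := by unfold regNorm; fun_prop
  have h := this.tendsto 0
  have h0 : regNorm 0 z = ‖z‖ := by simp [regNorm]
  rw [h0] at h
  exact h.mono_left nhdsWithin_le_nhds

/-- The `j`-th standard basis vector of space, as a direction in space-time. -/
def spaceDir (j : Fin 3) : Event := (EuclideanSpace.single j 1, 0)

/-- The time direction. -/
def timeDir : Event := (0, 1)

lemma hasDerivAt_coord (z : Space) (j : Fin 3) :
    HasDerivAt (fun t : ℝ => (z + t • EuclideanSpace.single j (1 : ℝ)) j) 1 0 := by
  simpa using (hasDerivAt_id (0 : ℝ)).const_add (z j)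

lemma hasDerivAt_regNorm {ε : ℝ} (hε : 0 < ε) (z : Space) (j : Fin 3) :
    HasDerivAt (fun t : ℝ => regNorm ε (z + t • EuclideanSpace.single j (1 : ℝ)))
      (z j / regNorm ε z) 0 := by
  have h0 : HasDerivAt (fun t : ℝ => z + t • EuclideanSpace.single j (1 : ℝ))
      (EuclideanSpace.single j (1 : ℝ)) 0 := by
    simpa using ((hasDerivAt_id (0 : ℝ)).smul_const (EuclideanSpace.single j (1 : ℝ))).const_add z
  have h1 := ((h0.norm_sq).add_const (ε ^ 2)).sqrt (by positivity)
  unfold regNorm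
  convert h1 using 1
  simp [EuclideanSpace.inner_single_right]
  field_simp

lemma hasDerivAt_comp_graph {ε : ℝ} (hε : 0 < ε) (z : Space) (j : Fin 3) (g : 𝓢(Event, E)) :
    HasDerivAt (fun t : ℝ => g (z + t • EuclideanSpace.single j (1 : ℝ),
        regNorm ε (z + t • EuclideanSpace.single j (1 : ℝ)) / C))
      ((∂_{spaceDir j} g) (z, regNorm ε z / C) +
        (z j / regNorm ε z / C) • (∂_{timeDir} g) (z, regNorm ε z / C)) 0 := by
  have h0 : HasDerivAt (fun t : ℝ => z + t • EuclideanSpace.single j (1 : ℝ))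
      (EuclideanSpace.single j (1 : ℝ)) 0 := by
    simpa using ((hasDerivAt_id (0 : ℝ)).smul_const (EuclideanSpace.single j (1 : ℝ))).const_add z
  have h1 := h0.prodMk ((hasDerivAt_regNorm hε z j).div_const C)
  have h2 := g.hasFDerivAt (z, regNorm ε z / C)
  have h3 := HasFDerivAt.comp_hasDerivAt_of_eq 0 h2 h1 (by simp)
  refine HasDerivAt.congr_deriv h3 ?_
  rw [lineDerivOp_apply_eq_fderiv, lineDerivOp_apply_eq_fderiv, ← map_smul, ← map_add]
  congr 1
  simp [spaceDir, timeDir]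

/-- The `j`-th component of the vector field
`ρ⁻¹ ∇f - C⁻¹ ρ⁻² z ∂ₜf + ρ⁻³ z f`, where `ρ = √(|z|² + ε²)` and `f` is taken at `(z, ρ / C)`.
Its divergence is the regularised wave operator applied to `f`, up to terms which vanish in the
limit `ε → 0` and one which tends to a multiple of the Dirac mass. -/
def waveField (C ε : ℝ) (f : 𝓢(Event, E)) (j : Fin 3) (z : Space) : E :=
  (regNorm ε z)⁻¹ • (∂_{spaceDir j} f) (z, regNorm ε z / C)
    - (z j / (C * regNorm ε z ^ 2)) • (∂_{timeDir} f) (z, regNorm ε z / C)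
    + (z j / regNorm ε z ^ 3) • f (z, regNorm ε z / C)

/-- The `j`-th summand of the divergence of `waveField`. -/
def waveFieldDeriv (C ε : ℝ) (f : 𝓢(Event, E)) (j : Fin 3) (z : Space) : E :=
  (regNorm ε z)⁻¹ • (∂_{spaceDir j} (∂_{spaceDir j} f)) (z, regNorm ε z / C)
    - (z j ^ 2 / (C ^ 2 * regNorm ε z ^ 3)) •
      (∂_{timeDir} (∂_{timeDir} f)) (z, regNorm ε z / C)
    + (-1 / (C * regNorm ε z ^ 2) + 3 * z j ^ 2 / (C * regNorm ε z ^ 4)) •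
      (∂_{timeDir} f) (z, regNorm ε z / C)
    + (1 / regNorm ε z ^ 3 - 3 * z j ^ 2 / regNorm ε z ^ 5) • f (z, regNorm ε z / C)

lemma hasLineDerivAt_waveField (hC : 0 < C) {ε : ℝ} (hε : 0 < ε) (f : 𝓢(Event, E)) (j : Fin 3)
    (z : Space) :
    HasLineDerivAt ℝ (waveField C ε f j) (waveFieldDeriv C ε f j z) z
      (EuclideanSpace.single j 1) := by
  have hρ := regNorm_pos hε z
  have hr := hasDerivAt_regNorm hε z j
  have hc := hasDerivAt_coord z j
  have hρ0 : regNorm ε (z + (0 : ℝ) • EuclideanSpace.single j (1 : ℝ)) ≠ 0 := by simpa using hρ.ne'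
  have h1 := (hr.inv hρ0).smul (hasDerivAt_comp_graph (C := C) hε z j (∂_{spaceDir j} f))
  have h2 := (hc.div ((hr.pow 2).const_mul C)
    (mul_ne_zero hC.ne' (pow_ne_zero 2 hρ0))).smul
      (hasDerivAt_comp_graph (C := C) hε z j (∂_{timeDir} f))
  have h3 := (hc.div (hr.pow 3) (pow_ne_zero 3 hρ0)).smul
    (hasDerivAt_comp_graph (C := C) hε z j f)
  have h := (h1.sub h2).add h3
  refine h.congr_deriv ?_
  rw [lineDerivOp_comm timeDir (spaceDir j) f]
  simp only [zero_smul, add_zero, waveFieldDeriv, Nat.cast_ofNat, Nat.add_one_sub_one, pow_one,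
    Pi.inv_apply, Pi.pow_apply, Pi.div_apply]
  generalize (∂_{spaceDir j} (∂_{spaceDir j} f)) (z, regNorm ε z / C) = fjj
  generalize (∂_{spaceDir j} (∂_{timeDir} f)) (z, regNorm ε z / C) = fjt
  generalize (∂_{timeDir} (∂_{timeDir} f)) (z, regNorm ε z / C) = ftt
  generalize (∂_{spaceDir j} f) (z, regNorm ε z / C) = fj
  generalize (∂_{timeDir} f) (z, regNorm ε z / C) = ft
  generalize f (z, regNorm ε z / C) = f0
  generalize regNorm ε z = ρ at *
  match_scalars <;> field_simp <;> ring

/-! ### The wave equation for the cone measure -/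

/-- The wave operator `∂ₜ² - C² Δ`. -/
def dAlembert (C : ℝ) (f : 𝓢(Event, E)) : 𝓢(Event, E) :=
  ∂_{timeDir} (∂_{timeDir} f) - C ^ 2 • ∑ j, ∂_{spaceDir j} (∂_{spaceDir j} f)

lemma dAlembert_apply (C : ℝ) (f : 𝓢(Event, E)) (X : Event) :
    dAlembert C f X = (∂_{timeDir} (∂_{timeDir} f)) X -
      C ^ 2 • ∑ j, (∂_{spaceDir j} (∂_{spaceDir j} f)) X := by
  simp [dAlembert, Fin.sum_univ_three]

lemma abs_div_regNorm_pow_le {ε : ℝ} {z : Space} (hz : z ≠ 0) {x K : ℝ} {p : ℕ} (m : ℕ)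
    (h : |x| ≤ K * regNorm ε z ^ p) : |x / regNorm ε z ^ (p + m)| ≤ K * (‖z‖ ^ m)⁻¹ := by
  have hz' : 0 < ‖z‖ := norm_pos_iff.2 hz
  have hρ : 0 < regNorm ε z := hz'.trans_le (norm_le_regNorm ε z)
  have hK : 0 ≤ K := by
    have := (abs_nonneg _).trans h
    exact nonneg_of_mul_nonneg_left this (by positivity)
  rw [abs_div, abs_of_pos (by positivity : 0 < regNorm ε z ^ (p + m)), pow_add]
  calc |x| / (regNorm ε z ^ p * regNorm ε z ^ m)
      ≤ K * regNorm ε z ^ p / (regNorm ε z ^ p * regNorm ε z ^ m) := by gcongr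
    _ = K * (regNorm ε z ^ m)⁻¹ := by field_simp
    _ ≤ K * (‖z‖ ^ m)⁻¹ := by
        gcongr
        exact norm_le_regNorm ε z

lemma measurable_regNorm (ε : ℝ) : Measurable (regNorm ε) := (continuous_regNorm ε).measurable

attribute [fun_prop] continuous_regNorm measurable_regNorm

lemma integrable_div_regNorm_smul {ε K : ℝ} {x : Space → ℝ} (hx : Measurable x) (p m : ℕ)
    (hm : m ≤ 2) (h : ∀ z, |x z| ≤ K * regNorm ε z ^ p) (g : 𝓢(Event, E)) :
    Integrable fun z => (x z / regNorm ε z ^ (p + m)) • g (z, regNorm ε z / C) :=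
  integrable_smul_graph (by fun_prop) (by fun_prop) hm
    (fun z hz => abs_div_regNorm_pow_le hz m (h z)) g

lemma integrable_waveField (ε : ℝ) (f : 𝓢(Event, E)) (j : Fin 3) :
    Integrable (waveField C ε f j) := by
  have hj := abs_coord_le_regNorm ε (j := j)
  have h1 := integrable_div_regNorm_smul (C := C) (ε := ε) (K := 1) (x := fun _ => 1)
    (by fun_prop) 0 1 (by norm_num) (by simp) (∂_{spaceDir j} f)
  have h2 := integrable_div_regNorm_smul (C := C) (ε := ε) (K := |C⁻¹|) (x := fun z => C⁻¹ * z j)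
    (by fun_prop) 1 1 (by norm_num)
    (fun z => by rw [abs_mul, pow_one]; gcongr; exact hj z) (∂_{timeDir} f)
  have h3 := integrable_div_regNorm_smul (C := C) (ε := ε) (K := 1) (x := fun z => z j)
    (by fun_prop) 1 2 (by norm_num)
    (fun z => by rw [one_mul, pow_one]; exact hj z) f
  refine ((h1.sub h2).add h3).congr (Eventually.of_forall fun z => ?_)
  simp only [Pi.add_apply, Pi.sub_apply, waveField]
  congr 3
  · simp
  · field_simp

lemma integrable_waveFieldDeriv (hC : 0 < C) {ε : ℝ} (hε : 0 < ε) (f : 𝓢(Event, E)) (j : Fin 3) :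
    Integrable (waveFieldDeriv C ε f j) := by
  have hj := abs_coord_le_regNorm ε (j := j)
  have hj2 : ∀ z : Space, z j ^ 2 ≤ regNorm ε z ^ 2 := fun z => by
    rw [← sq_abs]; gcongr; exact hj z
  have h1 := integrable_div_regNorm_smul (C := C) (ε := ε) (K := 1) (x := fun _ => 1)
    (by fun_prop) 0 1 (by norm_num) (by simp) (∂_{spaceDir j} (∂_{spaceDir j} f))
  have h2 := integrable_div_regNorm_smul (C := C) (ε := ε) (K := |(C ^ 2)⁻¹|)
    (x := fun z => (C ^ 2)⁻¹ * z j ^ 2) (by fun_prop) 2 1 (by norm_num)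
    (fun z => by
      rw [abs_mul, abs_of_nonneg (sq_nonneg (z j))]
      exact mul_le_mul_of_nonneg_left (hj2 z) (abs_nonneg _))
    (∂_{timeDir} (∂_{timeDir} f))
  have h3 := integrable_div_regNorm_smul (C := C) (ε := ε) (K := |C⁻¹| * 4)
    (x := fun z => C⁻¹ * (3 * z j ^ 2 - regNorm ε z ^ 2)) (by fun_prop) 2 2 (by norm_num)
    (fun z => by
      rw [abs_mul, mul_assoc]
      gcongr
      have := hj2 z
      rw [abs_le]
      constructor <;> nlinarith [sq_nonneg (z j), sq_nonneg (regNorm ε z)])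
    (∂_{timeDir} f)
  have h4 := integrable_div_regNorm_smul (C := C) (ε := ε) (K := 4 * (ε ^ 3)⁻¹)
    (x := fun z => regNorm ε z ^ 2 - 3 * z j ^ 2) (by fun_prop) 5 0 (by norm_num)
    (fun z => by
      have := hj2 z
      have hρ := regNorm_pos hε z
      have h5 : |regNorm ε z ^ 2 - 3 * z j ^ 2| ≤ 4 * regNorm ε z ^ 2 := by
        rw [abs_le]
        constructor <;> nlinarith [sq_nonneg (z j), sq_nonneg (regNorm ε z)]
      have h6 : 1 ≤ (ε ^ 3)⁻¹ * regNorm ε z ^ 3 := by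
        rw [inv_mul_eq_div, one_le_div (by positivity)]
        gcongr
        exact le_regNorm ε z
      calc _ ≤ 4 * regNorm ε z ^ 2 * 1 := by rw [mul_one]; exact h5
        _ ≤ 4 * regNorm ε z ^ 2 * ((ε ^ 3)⁻¹ * regNorm ε z ^ 3) := by gcongr
        _ = _ := by ring)
    f
  refine (((h1.sub h2).add h3).add h4).congr (Eventually.of_forall fun z => ?_)
  have hρ := (regNorm_pos hε z).ne'
  simp only [Pi.add_apply, Pi.sub_apply, waveFieldDeriv]
  simp only [Nat.reduceAdd]
  match_scalars <;> (field_simp; try ring)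

/-- The divergence of `waveField`. In the limit `ε → 0` the first term becomes the
wave operator on the cone, the last one is an approximate Dirac mass, and the others vanish. -/
lemma sum_waveFieldDeriv (hC : 0 < C) {ε : ℝ} (hε : 0 < ε) (f : 𝓢(Event, E)) (z : Space) :
    ∑ j, waveFieldDeriv C ε f j z =
      (-(C ^ 2)⁻¹ / regNorm ε z ^ (0 + 1)) • dAlembert C f (z, regNorm ε z / C)
      + ((C ^ 2)⁻¹ * ε ^ 2 / regNorm ε z ^ (2 + 1)) •
          (∂_{timeDir} (∂_{timeDir} f)) (z, regNorm ε z / C)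
      - (3 * C⁻¹ * ε ^ 2 / regNorm ε z ^ (2 + 2)) • (∂_{timeDir} f) (z, regNorm ε z / C)
      + (3 * ε ^ 2 / regNorm ε z ^ (5 + 0)) • f (z, regNorm ε z / C) := by
  have hρ := (regNorm_pos hε z).ne'
  have h := regNorm_sq ε z
  rw [EuclideanSpace.real_norm_sq_eq, Fin.sum_univ_three] at h
  have h' : ε ^ 2 = regNorm ε z ^ 2 - (z 0 ^ 2 + z 1 ^ 2 + z 2 ^ 2) := by rw [h]; ring
  rw [Fin.sum_univ_three, dAlembert_apply, Fin.sum_univ_three, h']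
  simp only [waveFieldDeriv]
  generalize regNorm ε z = ρ at *
  match_scalars <;> (field_simp; try ring)

/-- In polar coordinates the integrand has the primitive `r³ / (1 + r²) ^ (3 / 2)`. -/
lemma integral_three_div_regNorm_pow :
    ∫ z : Space, 3 / regNorm 1 z ^ 5 = 4 * Real.pi := by
  have hpos : ∀ y : ℝ, 0 < √(y ^ 2 + 1) := fun y => Real.sqrt_pos.2 (by positivity)
  have hsq : ∀ y : ℝ, √(y ^ 2 + 1) ^ 2 = y ^ 2 + 1 := fun y => Real.sq_sqrt (by positivity)
  have hderiv : ∀ y ∈ Set.Ici (0 : ℝ), HasDerivAt (fun y : ℝ => y ^ 3 / √(y ^ 2 + 1) ^ 3)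
      (y ^ 2 * (3 / √(y ^ 2 + 1) ^ 5)) y := fun y _ => by
    have h1 : HasDerivAt (fun y : ℝ => √(y ^ 2 + 1)) (y / √(y ^ 2 + 1)) y := by
      have := (((hasDerivAt_id y).pow 2).add_const (1 : ℝ)).sqrt
        (by have : 0 < y ^ 2 + 1 := by positivity
            simpa using this.ne')
      refine this.congr_deriv ?_
      simp
      field_simp
    have h2 := ((hasDerivAt_id y).pow 3).div (h1.pow 3) (pow_ne_zero 3 (hpos y).ne')
    refine h2.congr_deriv ?_
    have h3 := hsq y
    have h4 := (hpos y).ne'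
    simp only [id, Pi.pow_apply, Nat.cast_ofNat, Nat.add_one_sub_one, mul_one]
    generalize √(y ^ 2 + 1) = r at *
    field_simp
    linear_combination y ^ 2 * h3
  have hlim : Tendsto (fun y : ℝ => y ^ 3 / √(y ^ 2 + 1) ^ 3) atTop (𝓝 1) := by
    have h1 : Tendsto (fun y : ℝ => (√(1 + (y ^ 2)⁻¹) ^ 3)⁻¹) atTop (𝓝 1) := by
      have h2 : Tendsto (fun y : ℝ => (y ^ 2)⁻¹) atTop (𝓝 0) :=
        (tendsto_pow_atTop (by norm_num)).inv_tendsto_atTop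
      have h3 : ContinuousAt (fun x : ℝ => (√(1 + x) ^ 3)⁻¹) 0 := by
        refine ContinuousAt.inv₀ (by fun_prop) (by simp)
      have := h3.tendsto.comp h2
      simpa [Function.comp_def] using this
    refine h1.congr' ?_
    filter_upwards [eventually_gt_atTop 0] with y hy
    have : √(y ^ 2 + 1) = y * √(1 + (y ^ 2)⁻¹) := by
      rw [← Real.sqrt_sq hy.le, ← Real.sqrt_mul (sq_nonneg _), Real.sqrt_sq hy.le]
      congr 1
      field_simp
    rw [this]
    have : 0 < √(1 + (y ^ 2)⁻¹) := Real.sqrt_pos.2 (by positivity)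
    field_simp
  have hint := integrableOn_Ioi_deriv_of_nonneg' hderiv
    (fun y _ => by have := hpos y; positivity) hlim
  have h := integral_Ioi_of_hasDerivAt_of_tendsto' hderiv hint hlim
  have h0 := integral_fun_norm_addHaar (volume : Measure Space) (fun y : ℝ => 3 / √(y ^ 2 + 1) ^ 5)
  simp only [finrank_euclideanSpace, Fintype.card_fin, Nat.add_one_sub_one, smul_eq_mul, h] at h0
  simp only [regNorm, one_pow, h0, Measure.real, EuclideanSpace.volume_ball_fin_three]
  simp [ENNReal.toReal_ofReal (by positivity : 0 ≤ Real.pi * 4 / 3)]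
  ring

lemma integrable_three_div_regNorm_pow : Integrable fun z : Space => 3 / regNorm 1 z ^ 5 := by
  -- otherwise the integral would have the junk value zero
  by_contra h
  have := integral_three_div_regNorm_pow
  rw [integral_undef h] at this
  have := Real.pi_pos
  linarith

/-- The kernels `3 ε² / (|z|² + ε²) ^ (5 / 2)` are an approximate Dirac mass of weight `4 π`. -/
lemma tendsto_diracTerm [CompleteSpace E] (f : 𝓢(Event, E)) :
    Tendsto (fun ε => ∫ z, (3 * ε ^ 2 / regNorm ε z ^ (5 + 0)) • f (z, regNorm ε z / C))
      (𝓝[>] 0) (𝓝 ((4 * Real.pi) • f 0)) := by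
  -- the substitution of `ε z` for `z`
  have hscale : ∀ ε > 0, ∫ z, (3 * ε ^ 2 / regNorm ε z ^ (5 + 0)) • f (z, regNorm ε z / C) =
      ∫ z, (3 / regNorm 1 z ^ 5) • f (ε • z, ε * regNorm 1 z / C) := fun ε hε => by
    have h1 := Measure.integral_comp_smul (volume : Measure Space)
      (fun z => (3 * ε ^ 2 / regNorm ε z ^ (5 + 0)) • f (z, regNorm ε z / C)) ε
    have h2 : ∀ z, regNorm ε (ε • z) = ε * regNorm 1 z := fun z => by
      unfold regNorm
      rw [norm_smul, Real.norm_of_nonneg hε.le, ← Real.sqrt_sq hε.le, ← Real.sqrt_mul (sq_nonneg _),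
        Real.sqrt_sq hε.le]
      congr 1
      ring
    have h3 : |(ε ^ 3)⁻¹| = (ε ^ 3)⁻¹ := abs_of_pos (by positivity)
    simp only [finrank_euclideanSpace, Fintype.card_fin, h2, h3] at h1
    rw [eq_comm, inv_smul_eq_iff₀ (by positivity), ← integral_smul] at h1
    rw [h1]
    refine integral_congr_ae (Eventually.of_forall fun z => ?_)
    simp only [smul_smul]
    congr 1
    have := regNorm_pos one_pos z
    simp only [add_zero]
    field_simp
  obtain ⟨M, hM0, hM⟩ := exists_norm_graph_le f
  rw [← integral_three_div_regNorm_pow, ← integral_smul_const]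
  refine Tendsto.congr' (f₁ := fun ε => ∫ z, (3 / regNorm 1 z ^ 5) •
    f (ε • z, ε * regNorm 1 z / C)) ?_ ?_
  · filter_upwards [self_mem_nhdsWithin] with ε hε using (hscale ε hε).symm
  refine tendsto_integral_filter_of_dominated_convergence (fun z => 3 / regNorm 1 z ^ 5 * M) ?_ ?_
    (integrable_three_div_regNorm_pow.mul_const M) ?_
  · refine Eventually.of_forall fun ε => ?_
    have h1 : Continuous fun z : Space => f (ε • z, ε * regNorm 1 z / C) :=
      f.continuous.comp (by fun_prop)
    have h2 : Measurable fun z : Space => 3 / regNorm 1 z ^ 5 := by fun_prop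
    exact h2.aestronglyMeasurable.smul h1.aestronglyMeasurable
  · refine Eventually.of_forall fun ε => Eventually.of_forall fun z => ?_
    have := regNorm_pos one_pos z
    rw [norm_smul, Real.norm_of_nonneg (by positivity)]
    gcongr
    refine (hM _ _).trans (mul_le_of_le_one_right hM0 (inv_le_one_of_one_le₀ ?_))
    exact one_le_pow₀ (by simp)
  · refine Eventually.of_forall fun z => ?_
    refine Tendsto.smul tendsto_const_nhds ?_
    have h1 : Continuous fun ε : ℝ => f (ε • z, ε * regNorm 1 z / C) :=
      f.continuous.comp (by fun_prop)
    have h2 := h1.tendsto 0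
    simp only [zero_smul, zero_mul, zero_div] at h2
    exact h2.mono_left nhdsWithin_le_nhds

/-- The measure `d³z / |z|` on the forward light cone is, up to the factor `4 π C²`, a
fundamental solution of the wave equation. -/
theorem integral_dAlembert_lightCone [CompleteSpace E] (hC : 0 < C) (f : 𝓢(Event, E)) :
    ∫ Y, dAlembert C f Y ∂lightCone C = (4 * Real.pi * C ^ 2) • f 0 := by
  have hε2 : ∀ ε : ℝ, ∀ z, |ε ^ 2| ≤ regNorm ε z ^ 2 := fun ε z => by
    rw [regNorm_sq, abs_of_nonneg (sq_nonneg _)]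
    nlinarith [sq_nonneg ‖z‖]
  have bA : ∀ ε z, |-(C ^ 2)⁻¹| ≤ |(C ^ 2)⁻¹| * regNorm ε z ^ 0 := by simp
  have bB : ∀ ε z, |(C ^ 2)⁻¹ * ε ^ 2| ≤ |(C ^ 2)⁻¹| * regNorm ε z ^ 2 := fun ε z => by
    rw [abs_mul]; gcongr; exact hε2 ε z
  have bD : ∀ ε z, |3 * C⁻¹ * ε ^ 2| ≤ |3 * C⁻¹| * regNorm ε z ^ 2 := fun ε z => by
    rw [abs_mul]; gcongr; exact hε2 ε z
  have bG : ∀ ε > 0, ∀ z, |3 * ε ^ 2| ≤ 3 * ε ^ 2 * (ε ^ 5)⁻¹ * regNorm ε z ^ 5 :=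
    fun ε hε z => by
      rw [abs_of_pos (by positivity), mul_assoc]
      refine le_mul_of_one_le_right (by positivity) ?_
      rw [inv_mul_eq_div, one_le_div (by positivity)]
      gcongr
      exact le_regNorm ε z
  -- the integral of the divergence of `waveField` vanishes
  have hzero : ∀ ε > 0,
      (∫ z, (-(C ^ 2)⁻¹ / regNorm ε z ^ (0 + 1)) • dAlembert C f (z, regNorm ε z / C))
      + (∫ z, ((C ^ 2)⁻¹ * ε ^ 2 / regNorm ε z ^ (2 + 1)) •
          (∂_{timeDir} (∂_{timeDir} f)) (z, regNorm ε z / C))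
      - (∫ z, (3 * C⁻¹ * ε ^ 2 / regNorm ε z ^ (2 + 2)) • (∂_{timeDir} f) (z, regNorm ε z / C))
      + (∫ z, (3 * ε ^ 2 / regNorm ε z ^ (5 + 0)) • f (z, regNorm ε z / C)) = 0 := fun ε hε => by
    have hA := integrable_div_regNorm_smul (C := C) measurable_const 0 1 (by norm_num) (bA ε)
      (dAlembert C f)
    have hB := integrable_div_regNorm_smul (C := C) measurable_const 2 1 (by norm_num) (bB ε)
      (∂_{timeDir} (∂_{timeDir} f))
    have hD := integrable_div_regNorm_smul (C := C) measurable_const 2 2 (by norm_num) (bD ε)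
      (∂_{timeDir} f)
    have hG := integrable_div_regNorm_smul (C := C) measurable_const 5 0 (by norm_num)
      (bG ε hε) f
    have e1 := integral_add hA hB
    have e2 := integral_sub (hA.add hB) hD
    have e3 := integral_add ((hA.add hB).sub hD) hG
    simp only [Pi.add_apply, Pi.sub_apply] at e2 e3
    rw [← e1, ← e2, ← e3]
    simp_rw [← sum_waveFieldDeriv hC hε f]
    rw [integral_finsetSum _ fun j _ => integrable_waveFieldDeriv hC hε f j]
    refine Finset.sum_eq_zero fun j _ => ?_
    exact integral_lineDeriv_eq_zero (hasLineDerivAt_waveField hC hε f j)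
      (integrable_waveField ε f j) (integrable_waveFieldDeriv hC hε f j)
  have hs : ∀ ε, Continuous fun z => regNorm ε z / C := fun ε => by fun_prop
  have hs0 : ∀ z : Space, z ≠ 0 → Tendsto (fun ε => regNorm ε z / C) (𝓝[>] 0) (𝓝 (‖z‖ / C)) :=
    fun z _ => (tendsto_regNorm z).div_const C
  have hl : ∀ (x : ℝ → ℝ), Continuous x → ∀ p : ℕ, ∀ z : Space, z ≠ 0 →
      Tendsto (fun ε => x ε / regNorm ε z ^ p) (𝓝[>] 0) (𝓝 (x 0 / ‖z‖ ^ p)) :=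
    fun x hx p z hz => ((hx.tendsto 0).mono_left nhdsWithin_le_nhds).div
      ((tendsto_regNorm z).pow p) (pow_ne_zero _ (norm_ne_zero_iff.2 hz))
  have lA := tendsto_integral_smul_graph (m := 1) (fun ε => by fun_prop) hs (by norm_num)
    (fun ε _ z hz => abs_div_regNorm_pow_le hz 1 (bA ε z)) (hl _ (by fun_prop) _) hs0
    (dAlembert C f)
  have lB := tendsto_integral_smul_graph (m := 1) (fun ε => by fun_prop) hs (by norm_num)
    (fun ε _ z hz => abs_div_regNorm_pow_le hz 1 (bB ε z)) (hl _ (by fun_prop) _) hs0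
    (∂_{timeDir} (∂_{timeDir} f))
  have lD := tendsto_integral_smul_graph (m := 2) (fun ε => by fun_prop) hs (by norm_num)
    (fun ε _ z hz => abs_div_regNorm_pow_le hz 2 (bD ε z)) (hl _ (by fun_prop) _) hs0
    (∂_{timeDir} f)
  have lim := ((lA.add lB).sub lD).add (tendsto_diracTerm (C := C) f)
  have lim0 : Tendsto (fun _ : ℝ => (0 : E)) (𝓝[>] 0) (𝓝 0) := tendsto_const_nhds
  have heq := tendsto_nhds_unique (lim.congr' (by
    filter_upwards [self_mem_nhdsWithin] with ε hε using hzero ε hε)) lim0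
  simp only [ne_eq, OfNat.ofNat_ne_zero, not_false_eq_true, zero_pow, mul_zero, zero_div, zero_smul,
    integral_zero, add_zero, sub_zero] at heq
  rw [integral_lightCone]
  have h1 : ∀ z : Space, (-(C ^ 2)⁻¹ / ‖z‖ ^ (0 + 1)) • dAlembert C f (z, ‖z‖ / C) =
      (-(C ^ 2)⁻¹) • ‖z‖⁻¹ • dAlembert C f (conePoint C z) := fun z => by
    rw [smul_smul, zero_add, pow_one, div_eq_mul_inv]
    rfl
  simp_rw [h1, integral_smul] at heq
  rw [neg_smul, neg_add_eq_zero, inv_smul_eq_iff₀ (by positivity), smul_smul] at heq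
  rw [heq]
  congr 1
  ring

end WaveEquation

/-! ### The Fourier transform on space-time -/

section Fourier

variable {F : Type} [NormedAddCommGroup F] [NormedSpace ℂ F]

lemma phase_comm (p X : Event) : phase p X = phase X p := by
  simp only [phase, real_inner_comm, mul_comm]

/-- The phase of a plane wave, divided by `2 π`, as a continuous bilinear form. -/
def phaseForm : Event →L[ℝ] Event →L[ℝ] ℝ :=
  let A : Event →L[ℝ] Event →L[ℝ] ℝ := (innerSL ℝ).bilinearComp
    (ContinuousLinearMap.fst ℝ Space ℝ) (ContinuousLinearMap.fst ℝ Space ℝ)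
  let B : Event →L[ℝ] Event →L[ℝ] ℝ := (ContinuousLinearMap.mul ℝ ℝ).bilinearComp
    (ContinuousLinearMap.snd ℝ Space ℝ) (ContinuousLinearMap.snd ℝ Space ℝ)
  (2 * Real.pi)⁻¹ • (A - B)

lemma phaseForm_apply (p X : Event) : phaseForm p X = (2 * Real.pi)⁻¹ * phase p X := by
  simp [phaseForm, phase]

lemma phaseForm_flip : phaseForm.toLinearMap₁₂.flip = phaseForm.toLinearMap₁₂ := by
  ext p X <;> simp [phaseForm_apply, phase_comm]

lemma fourierChar_phaseForm_smul (X p : Event) (v : F) :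
    𝐞 (-phaseForm X p) • v = Complex.exp (-Complex.I * (phase p X : ℂ)) • v := by
  rw [Circle.smul_def, Real.fourierChar_apply, phaseForm_apply, phase_comm]
  congr 2
  have : (Real.pi : ℂ) ≠ 0 := by exact_mod_cast Real.pi_ne_zero
  push_cast
  field_simp

lemma fourierT_eq (φ : Event → F) :
    fourierT φ = fun p => (((2 * Real.pi) ^ 2)⁻¹ : ℝ) •
      VectorFourier.fourierIntegral 𝐞 volume phaseForm.toLinearMap₁₂ φ p := by
  ext1 p
  rw [fourierT, VectorFourier.fourierIntegral]
  congr 2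
  ext1 X
  exact (fourierChar_phaseForm_smul X p (φ X)).symm

lemma fourierT_def (φ : Event → F) (p : Event) :
    fourierT φ p = (((2 * Real.pi) ^ 2)⁻¹ : ℝ) •
      ∫ X : Event, Complex.exp (-Complex.I * (phase p X : ℂ)) • φ X := rfl

lemma continuous_phaseForm :
    Continuous fun p : Event × Event => phaseForm.toLinearMap₁₂ p.1 p.2 :=
  phaseForm.continuous₂

/-- The Fourier transform is symmetric for the bilinear pairing. -/
lemma integral_fourierT_smul [CompleteSpace F] {g : Event → ℂ} {φ : Event → F} (hg : Integrable g)
    (hφ : Integrable φ) :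
    ∫ X, fourierT g X • φ X = ∫ p, g p • fourierT φ p := by
  have := VectorFourier.integral_fourierIntegral_smul_eq_flip (L := phaseForm.toLinearMap₁₂)
    Real.continuous_fourierChar continuous_phaseForm hg hφ
  rw [phaseForm_flip] at this
  simp only [fourierT_eq, smul_assoc, smul_comm (g _) (((2 * Real.pi) ^ 2)⁻¹ : ℝ)]
  rw [integral_smul, integral_smul, this]

lemma fourierT_comp_sub (φ : Event → F) (Y p : Event) :
    fourierT (fun X => φ (X - Y)) p =
      Complex.exp (-Complex.I * (phase p Y : ℂ)) • fourierT φ p := by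
  rw [fourierT_def, fourierT_def, smul_comm (Complex.exp _)]
  congr 1
  rw [← integral_smul]
  have h := integral_sub_right_eq_self
    (fun X => Complex.exp (-Complex.I * (phase p (X + Y) : ℂ)) • φ X) (μ := volume) Y
  simp only [sub_add_cancel] at h
  rw [h]
  refine integral_congr_ae (Eventually.of_forall fun X => ?_)
  simp only [smul_smul, ← Complex.exp_add]
  congr 2
  simp only [phase, Prod.fst_add, Prod.snd_add, inner_add_right]
  push_cast
  ring

/-- Pairing `F[g]` with a translate of `φ` gives the Fourier transform of `g F[φ]`, taken at the
translation vector. -/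
lemma integral_fourierT_smul_comp_sub [CompleteSpace F] {g : Event → ℂ} {φ : Event → F}
    (hg : Integrable g) (hφ : Integrable φ) (Y : Event) :
    ∫ X, fourierT g X • φ (X - Y) =
      ((2 * Real.pi) ^ 2) • fourierT (fun p => g p • fourierT φ p) Y := by
  rw [integral_fourierT_smul hg (hφ.comp_sub_right Y), fourierT_def (F := F) _ Y, smul_smul,
    mul_inv_cancel₀ (by positivity), one_smul]
  refine integral_congr_ae (Eventually.of_forall fun p => ?_)
  simp only [fourierT_comp_sub, phase_comm p Y]
  rw [smul_comm]

/-- The Fourier transform intertwines the boosts of wave data and of events. -/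
lemma fourierT_comp_boostWave {C : ℝ} {u : Space} (hC : 0 < C) (hu : ‖u‖ < C) (g : Event → F)
    (X : Event) :
    fourierT (fun p => g (boostWave C u p)) X = fourierT g (boostEvent C u X) := by
  rw [fourierT_def, fourierT_def]
  congr 1
  have h := (measurePreserving_boostWave hC hu).integral_comp
    (boostWaveEquiv hC hu).toHomeomorph.measurableEmbedding
    (fun p => Complex.exp (-Complex.I * (phase (boostEvent C u X) p : ℂ)) • g p)
  rw [← h]
  refine integral_congr_ae (Eventually.of_forall fun p => ?_)
  simp only [boostWaveEquiv_apply]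
  rw [phase_comm (boostEvent C u X), phase_boost hC hu, phase_comm]

/-- The linear map `(x, t) ↦ (x, -t) / (2 π)` into the Hilbert space of events, which turns the
phase into the inner product. -/
def phaseEquiv : Event ≃L[ℝ] WithLp 2 (Space × ℝ) :=
  ((ContinuousLinearEquiv.smulLeft (Units.mk0 (2 * Real.pi)⁻¹
      (inv_ne_zero (mul_pos two_pos Real.pi_pos).ne')) : Space ≃L[ℝ] Space).prodCongr
    (ContinuousLinearEquiv.smulLeft (Units.mk0 (-(2 * Real.pi)⁻¹)
      (neg_ne_zero.2 (inv_ne_zero (mul_pos two_pos Real.pi_pos).ne'))))).trans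
    (WithLp.prodContinuousLinearEquiv 2 ℝ Space ℝ).symm

lemma phaseEquiv_apply (p : Event) :
    phaseEquiv p = WithLp.toLp 2 ((2 * Real.pi)⁻¹ • p.1, -(2 * Real.pi)⁻¹ * p.2) := rfl

variable (F) in
/-- The Fourier transform as a continuous linear operator on Schwartz functions. -/
def fourierCLM : 𝓢(Event, F) →L[ℂ] 𝓢(Event, F) :=
  ((((2 * Real.pi) ^ 2)⁻¹ : ℝ) : ℂ) •
    (compCLMOfContinuousLinearEquiv ℂ phaseEquiv ∘L
      (fourierTransformCLM ℂ ∘L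
        compCLMOfContinuousLinearEquiv ℂ (WithLp.prodContinuousLinearEquiv 2 ℝ Space ℝ)))

lemma coe_fourierCLM (φ : 𝓢(Event, F)) : ⇑(fourierCLM F φ) = fourierT φ := by
  ext1 p
  rw [fourierT_eq]
  simp only [fourierCLM, smul_apply, ContinuousLinearMap.comp_apply,
    compCLMOfContinuousLinearEquiv_apply, Function.comp_apply,
    fourierTransformCLM_apply, fourier_coe, Real.fourier_eq, Complex.coe_smul]
  congr 1
  have h := (WithLp.volume_preserving_ofLp (U := Space) (V := ℝ)).integral_comp
    (WithLp.prodContinuousLinearEquiv 2 ℝ Space ℝ).toHomeomorph.measurableEmbedding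
    (fun X => 𝐞 (-phaseForm X p) • φ X)
  refine Eq.trans ?_ h
  refine integral_congr_ae (Eventually.of_forall fun Y => ?_)
  simp only
  congr 3
  rw [phaseForm_apply]
  simp only [phaseEquiv_apply, phase,
    WithLp.prod_inner_apply, real_inner_smul_right, RCLike.inner_apply, conj_trivial]
  ring

lemma hasTemperateGrowth_phase (v : Event) :
    (fun p : Event => phase p v).HasTemperateGrowth := by
  have := ((2 * Real.pi) • phaseForm.flip v).hasTemperateGrowth
  convert this using 1
  ext p
  have := Real.pi_ne_zero
  simp [phaseForm_apply]
  field_simp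

/-- Differentiating a Fourier transform multiplies the function by `-i` times the phase. -/
lemma lineDerivOp_fourierCLM (v : Event) (φ : 𝓢(Event, F)) :
    ∂_{v} (fourierCLM F φ) =
      (-Complex.I) • fourierCLM F (smulLeftCLM F (fun p : Event => phase p v) φ) := by
  ext X
  have h2 := VectorFourier.hasFDerivAt_fourierIntegral phaseForm (μ := volume) φ.integrable
    (by simpa using φ.integrable_pow_mul volume 1) X
  have h3 : HasFDerivAt (fun p => (((2 * Real.pi) ^ 2)⁻¹ : ℝ) •
      VectorFourier.fourierIntegral 𝐞 volume phaseForm.toLinearMap₁₂ φ p) _ X :=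
    h2.const_smul (((2 * Real.pi) ^ 2)⁻¹ : ℝ)
  have hint : Integrable (VectorFourier.fourierSMulRight phaseForm φ) := by
    refine ((φ.integrable_pow_mul volume 1).const_mul (2 * Real.pi * ‖phaseForm‖)).mono'
      ?_ (Eventually.of_forall fun X => ?_)
    · exact (φ.continuous.aestronglyMeasurable).fourierSMulRight
    · simpa [mul_assoc] using VectorFourier.norm_fourierSMulRight_le phaseForm φ X
  change _ = (-Complex.I) • fourierCLM F (smulLeftCLM F (fun p : Event => phase p v) φ) X
  rw [lineDerivOp_apply_eq_fderiv, coe_fourierCLM, fourierT_eq, HasFDerivAt.fderiv h3,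
    coe_fourierCLM, fourierT_eq, smul_comm, smul_apply]
  rw [VectorFourier.fourierIntegral_continuousLinearMap_apply Real.continuous_fourierChar hint]
  congr 1
  have : (fun x => (VectorFourier.fourierSMulRight phaseForm φ x) v) =
      (-Complex.I) • ⇑(smulLeftCLM F (fun p : Event => phase p v) φ) := by
    ext1 Y
    rw [Pi.smul_apply, smulLeftCLM_apply_apply (hasTemperateGrowth_phase v),
      VectorFourier.fourierSMulRight_apply, phaseForm_apply, ← Complex.coe_smul,
      ← Complex.coe_smul, smul_smul, smul_smul]
    congr 1
    have : (Real.pi : ℂ) ≠ 0 := by exact_mod_cast Real.pi_ne_zero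
    push_cast
    field_simp
  rw [this, VectorFourier.fourierIntegral_const_smul]
  rfl

lemma lineDerivOp_lineDerivOp_fourierCLM (v : Event) (φ : 𝓢(Event, F)) :
    ∂_{v} (∂_{v} (fourierCLM F φ)) =
      -fourierCLM F (smulLeftCLM F (fun p : Event => phase p v ^ 2) φ) := by
  have h := hasTemperateGrowth_phase v
  have h2 : (fun p : Event => phase p v ^ 2) =
      (fun p : Event => phase p v) * (fun p : Event => phase p v) := by
    ext p; simp [sq]
  rw [lineDerivOp_fourierCLM, lineDerivOp_smul, lineDerivOp_fourierCLM, smul_smul,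
    smulLeftCLM_smulLeftCLM_apply h h, h2]
  simp

/-- The symbol `C² |k|² - w²` of the wave operator. -/
def symbol (C : ℝ) (p : Event) : ℝ := C ^ 2 * ‖p.1‖ ^ 2 - p.2 ^ 2

lemma symbol_eq (C : ℝ) (p : Event) :
    symbol C p = C ^ 2 * ∑ j, phase p (spaceDir j) ^ 2 - phase p timeDir ^ 2 := by
  simp [symbol, phase, spaceDir, timeDir, EuclideanSpace.real_norm_sq_eq,
    EuclideanSpace.inner_single_right]

lemma hasTemperateGrowth_symbol (C : ℝ) : (symbol C).HasTemperateGrowth := by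
  have h : symbol C = (fun _ => C ^ 2) * (fun p => ∑ j, phase p (spaceDir j) ^ 2) -
      (fun p => phase p timeDir ^ 2) := by
    ext p; simp [symbol_eq]
  rw [h]
  exact ((Function.HasTemperateGrowth.const _).mul
    (Function.HasTemperateGrowth.sum fun j _ => (hasTemperateGrowth_phase (spaceDir j)).pow 2)).sub
    ((hasTemperateGrowth_phase timeDir).pow 2)

/-- The Fourier transform turns multiplication by the symbol into the wave operator. -/
lemma dAlembert_fourierCLM (C : ℝ) (φ : 𝓢(Event, F)) :
    dAlembert C (fourierCLM F φ) = fourierCLM F (smulLeftCLM F (symbol C) φ) := by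
  have h : smulLeftCLM F (symbol C) φ =
      C ^ 2 • (∑ j, smulLeftCLM F (fun p : Event => phase p (spaceDir j) ^ 2) φ) -
        smulLeftCLM F (fun p : Event => phase p timeDir ^ 2) φ := by
    ext p
    have hs : ∀ v : Event, (fun p : Event => phase p v ^ 2).HasTemperateGrowth :=
      fun v => (hasTemperateGrowth_phase v).pow 2
    simp only [Fin.sum_univ_three, sub_apply, smul_apply,
      add_apply, smulLeftCLM_apply_apply (hs _),
      smulLeftCLM_apply_apply (hasTemperateGrowth_symbol C), symbol_eq]
    module
  have hr : ∀ (c : ℝ) (ψ : 𝓢(Event, F)), fourierCLM F (c • ψ) = c • fourierCLM F ψ := fun c ψ => by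
    have h1 : ∀ χ : 𝓢(Event, F), c • χ = (c : ℂ) • χ := fun χ => by ext p; simp
    rw [h1, h1, map_smul]
  rw [h, dAlembert, map_sub, hr, map_sum]
  simp only [lineDerivOp_lineDerivOp_fourierCLM, Finset.sum_neg_distrib, smul_neg]
  abel

end Fourier

/-! ### Retarded potentials and their spectra -/

section Potentials

variable {C μ₀ : ℝ} {u : Space}

lemma retardedIntegrand_eq (J : Event → FourVec ℂ) (X : Event) :
    retardedIntegrand C J X = fun z => ‖z‖⁻¹ • J (X - conePoint C z) := rfl

/-- The retarded potentials are the convolution with the cone measure. -/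
lemma retarded_eq (J : Event → FourVec ℂ) (X : Event) :
    retarded C μ₀ J X = (μ₀ / (4 * Real.pi)) • ∫ Y, J (X - Y) ∂lightCone C := by
  rw [integral_lightCone]
  rfl

/-- The translates of a Schwartz function decay at a rate which is locally uniform in the
translation. -/
lemma exists_norm_sub_le (J : 𝓢(Event, FourVec ℂ)) :
    ∃ M, 0 ≤ M ∧ ∀ X Y, ‖J (X - Y)‖ ≤ M * (1 + ‖X‖) ^ 4 * ((1 + ‖Y‖) ^ 4)⁻¹ := by
  refine ⟨2 ^ 4 * (Finset.Iic (4, 0)).sup (fun m => SchwartzMap.seminorm ℝ m.1 m.2) J,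
    by positivity, fun X Y => ?_⟩
  have h := one_add_le_sup_seminorm_apply (𝕜 := ℝ) (m := (4, 0)) le_rfl le_rfl J (X - Y)
  rw [norm_iteratedFDeriv_zero] at h
  rw [← div_eq_mul_inv, le_div_iff₀ (by positivity)]
  have h1 : 1 + ‖Y‖ ≤ (1 + ‖X‖) * (1 + ‖X - Y‖) := by
    have : ‖Y‖ ≤ ‖X‖ + ‖X - Y‖ := by
      have := norm_sub_le X (X - Y)
      rwa [sub_sub_cancel] at this
    nlinarith [mul_nonneg (norm_nonneg X) (norm_nonneg (X - Y))]
  calc ‖J (X - Y)‖ * (1 + ‖Y‖) ^ 4 ≤ ‖J (X - Y)‖ * ((1 + ‖X‖) * (1 + ‖X - Y‖)) ^ 4 := by gcongr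
    _ = ((1 + ‖X - Y‖) ^ 4 * ‖J (X - Y)‖) * (1 + ‖X‖) ^ 4 := by ring
    _ ≤ _ := by gcongr

lemma integrable_comp_sub_lightCone (J : 𝓢(Event, FourVec ℂ)) (X : Event) :
    Integrable (fun Y => J (X - Y)) (lightCone C) := by
  obtain ⟨M, -, hM⟩ := exists_norm_sub_le J
  exact (integrable_lightCone_pow.const_mul (M * (1 + ‖X‖) ^ 4)).mono'
    (J.continuous.comp (by fun_prop)).aestronglyMeasurable (Eventually.of_forall (hM X))

lemma continuous_retarded (J : 𝓢(Event, FourVec ℂ)) : Continuous (retarded C μ₀ J) := by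
  obtain ⟨M, hM0, hM⟩ := exists_norm_sub_le J
  have h : Continuous fun X => ∫ Y, J (X - Y) ∂lightCone C := by
    refine continuous_iff_continuousAt.2 fun X₀ => ?_
    refine continuousAt_of_dominated
      (bound := fun Y => M * (1 + (‖X₀‖ + 1)) ^ 4 * ((1 + ‖Y‖) ^ 4)⁻¹) ?_ ?_
      (integrable_lightCone_pow.const_mul _) ?_
    · exact Eventually.of_forall fun X => (integrable_comp_sub_lightCone J X).1
    · filter_upwards [Metric.ball_mem_nhds X₀ one_pos] with X hX
      refine Eventually.of_forall fun Y => (hM X Y).trans ?_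
      have : ‖X‖ ≤ ‖X₀‖ + 1 := by
        have h1 : ‖X - X₀‖ < 1 := by simpa [dist_eq_norm] using hX
        have h2 := norm_add_le X₀ (X - X₀)
        rw [add_sub_cancel] at h2
        linarith
      gcongr
    · exact Eventually.of_forall fun Y => (J.continuous.comp (by fun_prop)).continuousAt
  have h' : retarded C μ₀ J =
      fun X => (μ₀ / (4 * Real.pi)) • ∫ Y, J (X - Y) ∂lightCone C := funext (retarded_eq J)
  rw [h']
  exact h.const_smul (μ₀ / (4 * Real.pi))

/-- The retarded potentials are bounded: the kernel `|z|⁻¹` is integrable near the origin and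
bounded away from it. -/
lemma exists_norm_retarded_le (J : 𝓢(Event, FourVec ℂ)) :
    ∃ M, ∀ X, ‖retarded C μ₀ J X‖ ≤ M := by
  obtain ⟨M, hM0, hM⟩ := exists_norm_graph_le J
  have i0 := integrable_inv_norm_pow (m := 0) (by norm_num)
  have i1 := integrable_inv_norm_pow (m := 1) (by norm_num)
  simp only [pow_zero, inv_one, one_mul, pow_one] at i0 i1
  refine ⟨|μ₀ / (4 * Real.pi)| * ((∫ z : Space, M * (16 * (‖z‖⁻¹ * ((1 + ‖z‖) ^ 4)⁻¹))) +
    ∫ z : Space, M * ((1 + ‖z‖) ^ 4)⁻¹), fun X => ?_⟩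
  rw [retarded, norm_smul, Real.norm_eq_abs]
  gcongr
  rw [← integral_sub_left_eq_self (fun z : Space => M * ((1 + ‖z‖) ^ 4)⁻¹) volume X.1,
    ← integral_add ((i1.const_mul 16).const_mul M) ((i0.comp_sub_left X.1).const_mul M)]
  refine norm_integral_le_of_norm_le
    (((i1.const_mul 16).const_mul M).add ((i0.comp_sub_left X.1).const_mul M))
    (Eventually.of_forall fun z => ?_)
  rw [retardedIntegrand, norm_smul, norm_inv, norm_norm]
  have h1 := hM (X.1 - z) (X.2 - ‖z‖ / C)
  rcases le_total ‖z‖ 1 with hz | hz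
  · have h2 : ((1 + ‖X.1 - z‖) ^ 4)⁻¹ ≤ 1 :=
      inv_le_one_of_one_le₀ (one_le_pow₀ (by simp))
    have h3 : 1 ≤ 16 * ((1 + ‖z‖) ^ 4)⁻¹ := by
      rw [← div_eq_mul_inv, one_le_div (by positivity)]
      calc (1 + ‖z‖) ^ 4 ≤ (1 + 1) ^ 4 := by gcongr
        _ = 16 := by norm_num
    calc ‖z‖⁻¹ * ‖J (X.1 - z, X.2 - ‖z‖ / C)‖ ≤ ‖z‖⁻¹ * (M * 1) := by
          gcongr
          exact h1.trans (by gcongr)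
      _ ≤ ‖z‖⁻¹ * (M * (16 * ((1 + ‖z‖) ^ 4)⁻¹)) := by gcongr
      _ = M * (16 * (‖z‖⁻¹ * ((1 + ‖z‖) ^ 4)⁻¹)) := by ring
      _ ≤ _ := le_add_of_nonneg_right (by positivity)
  · calc ‖z‖⁻¹ * ‖J (X.1 - z, X.2 - ‖z‖ / C)‖ ≤ 1 * (M * ((1 + ‖X.1 - z‖) ^ 4)⁻¹) := by
          gcongr
          exact inv_le_one_of_one_le₀ hz
      _ = M * ((1 + ‖X.1 - z‖) ^ 4)⁻¹ := one_mul _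
      _ ≤ _ := le_add_of_nonneg_left (by positivity)

lemma measurePreserving_boostEvent_lightCone (hC : 0 < C) (hu : ‖u‖ < C) :
    MeasurePreserving (boostEventEquiv hC hu) (lightCone C) (lightCone C) :=
  ⟨(boostEventEquiv hC hu).continuous.measurable, map_boostEvent_lightCone hC hu⟩

lemma inferred_sub (hC : 0 < C) (hu : ‖u‖ < C) (J : Event → FourVec ℂ) (X Y : Event) :
    inferred C u J (X - Y) =
      lorentz C (-u) (J (boostEvent C u X - boostEventEquiv hC hu Y)) := by
  rw [inferred, ← boostEventEquiv_apply hC hu, ← boostEventEquiv_apply hC hu, map_sub]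

lemma integrable_retardedIntegrand (hC : 0 < C) (hu : ‖u‖ < C) (J : 𝓢(Event, FourVec ℂ))
    (X : Event) : Integrable (retardedIntegrand C (inferred C u J) X) := by
  have hu' : ‖-u‖ < C := by rwa [norm_neg]
  rw [retardedIntegrand_eq, ← integrable_lightCone_iff (f := fun Y => inferred C u J (X - Y))]
  simp only [inferred_sub hC hu]
  have h1 := (measurePreserving_boostEvent_lightCone hC hu).integrable_comp_of_integrable
    (integrable_comp_sub_lightCone J (boostEvent C u X))
  exact (lorentzEquiv ℂ hC hu' : FourVec ℂ →L[ℂ] FourVec ℂ).integrable_comp h1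

/-- The perceived potentials are the boosted potentials in the rest frame of the source: the
retarded potentials are Lorentz covariant. -/
lemma perceived_eq (hC : 0 < C) (hu : ‖u‖ < C) (J : Event → FourVec ℂ) (X : Event) :
    perceived C μ₀ u J X = lorentz C (-u) (retarded C μ₀ J (boostEvent C u X)) := by
  have hu' : ‖-u‖ < C := by rwa [norm_neg]
  rw [perceived, retarded_eq, retarded_eq]
  simp only [inferred_sub hC hu]
  rw [(measurePreserving_boostEvent_lightCone hC hu).integral_comp
    (boostEventEquiv hC hu).toHomeomorph.measurableEmbedding
    (fun Y => lorentz C (-u) (J (boostEvent C u X - Y)))]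
  have h := (lorentzEquiv ℂ hC hu').integral_comp_comm (μ := lightCone C)
    (fun Y => J (boostEvent C u X - Y))
  simp only [lorentzEquiv_apply] at h
  rw [h, ← Complex.coe_smul, ← Complex.coe_smul, lorentz_smul]

lemma boostEvent_zero (hC : 0 < C) (X : Event) : boostEvent C 0 X = X := by
  simp only [boostEvent, lorentz_zero]
  rw [mul_div_cancel_left₀ _ hC.ne']

lemma perceived_zero (hC : 0 < C) (J : Event → FourVec ℂ) :
    perceived C μ₀ 0 J = retarded C μ₀ J := by
  ext1 X
  rw [perceived_eq hC (by simpa using hC), neg_zero, lorentz_zero, boostEvent_zero hC]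

/-- The Lorentz covariance of the spectrum. -/
lemma spectrum_perceived (hC : 0 < C) (hu : ‖u‖ < C) (J : Event → FourVec ℂ) (g : Event → ℂ) :
    spectrum (perceived C μ₀ u J) g =
      lorentz C (-u) (spectrum (retarded C μ₀ J) fun p => g (boostWave C (-u) p)) := by
  have hu' : ‖-u‖ < C := by rwa [norm_neg]
  have h := (lorentzEquiv ℂ hC hu').integral_comp_comm (μ := volume)
    (fun X => fourierT (fun p => g (boostWave C (-u) p)) X • retarded C μ₀ J X)
  simp only [lorentzEquiv_apply] at h
  rw [spectrum, spectrum, ← h, ← (measurePreserving_boostEvent hC hu).integral_comp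
    (boostEventEquiv hC hu).toHomeomorph.measurableEmbedding
    (fun X => lorentz C (-u)
      (fourierT (fun p => g (boostWave C (-u) p)) X • retarded C μ₀ J X))]
  refine integral_congr_ae (Eventually.of_forall fun X => ?_)
  simp only
  rw [perceived_eq hC hu, lorentz_smul, fourierT_comp_boostWave hC hu',
    ← boostEventEquiv_symm_apply hC hu, ContinuousLinearEquiv.symm_apply_apply,
    boostEventEquiv_apply]

/-- The Fourier transform of a source, multiplied by a test function. -/
def windowed (J : 𝓢(Event, FourVec ℂ)) (g : 𝓢(Event, ℂ)) : 𝓢(Event, FourVec ℂ) :=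
  smulLeftCLM (FourVec ℂ) g (fourierCLM (FourVec ℂ) J)

lemma windowed_apply (J : 𝓢(Event, FourVec ℂ)) (g : 𝓢(Event, ℂ)) (p : Event) :
    windowed J g p = g p • fourierT J p := by
  rw [windowed, smulLeftCLM_apply_apply g.hasTemperateGrowth, coe_fourierCLM]

/-- The convolution theorem: the spectrum of the retarded potentials is the Fourier transform of
the cone measure multiplied by that of the source. -/
lemma spectrum_retarded (J : 𝓢(Event, FourVec ℂ)) (g : 𝓢(Event, ℂ)) :
    spectrum (retarded C μ₀ J) g =
      (μ₀ / (4 * Real.pi) * (2 * Real.pi) ^ 2) •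
        ∫ Y, fourierCLM (FourVec ℂ) (windowed J g) Y ∂lightCone C := by
  obtain ⟨M, hM0, hM⟩ := exists_norm_sub_le J
  have hg : ⇑(fourierCLM ℂ g) = fourierT g := coe_fourierCLM g
  have h1 : ∀ X, fourierT g X • retarded C μ₀ J X =
      (μ₀ / (4 * Real.pi)) • ∫ Y, fourierT g X • J (X - Y) ∂lightCone C := fun X => by
    rw [retarded_eq, integral_smul, smul_comm]
  -- Fubini's theorem applies, as the kernel is dominated by a product
  have hint : Integrable (Function.uncurry fun X Y => fourierT g X • J (X - Y))
      ((volume : Measure Event).prod (lightCone C)) := by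
    have i1 : Integrable fun X => (1 + ‖X‖) ^ 4 * ‖fourierT g X‖ := by
      have := fun k => (fourierCLM ℂ g).integrable_pow_mul volume k
      have h := ((((this 0).const_mul 1).add ((this 1).const_mul 4)).add
        ((this 2).const_mul 6)).add (((this 3).const_mul 4).add (this 4))
      refine h.congr (Eventually.of_forall fun X => ?_)
      simp only [Pi.add_apply, hg]
      ring
    refine ((i1.const_mul M).mul_prod (integrable_lightCone_pow (C := C))).mono' ?_ ?_
    · rw [← hg]
      have : Continuous (Function.uncurry fun X Y => fourierCLM ℂ g X • J (X - Y)) :=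
        ((fourierCLM ℂ g).continuous.comp continuous_fst).smul
          (J.continuous.comp (by fun_prop))
      exact this.aestronglyMeasurable
    · refine Eventually.of_forall fun Z => ?_
      simp only [Function.uncurry]
      rw [norm_smul]
      calc ‖fourierT g Z.1‖ * ‖J (Z.1 - Z.2)‖
          ≤ ‖fourierT g Z.1‖ * (M * (1 + ‖Z.1‖) ^ 4 * ((1 + ‖Z.2‖) ^ 4)⁻¹) := by
            gcongr
            exact hM _ _
        _ = _ := by ring
  have h2 : ⇑(windowed J g) = fun p => g p • fourierT J p := funext (windowed_apply J g)
  rw [spectrum]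
  simp_rw [h1]
  rw [integral_smul, integral_integral_swap hint, mul_smul]
  simp only [integral_fourierT_smul_comp_sub g.integrable J.integrable, coe_fourierCLM, h2,
    integral_smul]

/-- The wave equation for the spectrum of the retarded potentials. -/
lemma spectrum_retarded_symbol_mul (hC : 0 < C) (J : 𝓢(Event, FourVec ℂ)) (h : 𝓢(Event, ℂ)) :
    spectrum (retarded C μ₀ J) (smulLeftCLM ℂ (symbol C) h) =
      (μ₀ * C ^ 2) • ∫ p, h p • fourierT J p := by
  have h1 : windowed J (smulLeftCLM ℂ (symbol C) h) =
      smulLeftCLM (FourVec ℂ) (symbol C) (windowed J h) := by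
    ext1 p
    rw [windowed_apply, smulLeftCLM_apply_apply (hasTemperateGrowth_symbol C),
      smulLeftCLM_apply_apply (hasTemperateGrowth_symbol C), windowed_apply, smul_assoc]
  have h2 : ⇑(windowed J h) = fun p => h p • fourierT J p := funext (windowed_apply J h)
  rw [spectrum_retarded, h1, ← dAlembert_fourierCLM, integral_dAlembert_lightCone hC,
    coe_fourierCLM, fourierT_def, h2, smul_smul, smul_smul]
  have h3 : ∀ p : Event, phase 0 p = 0 := fun p => by simp [phase]
  simp only [h3, Complex.ofReal_zero, mul_zero, Complex.exp_zero, one_smul]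
  congr 1
  have := Real.pi_ne_zero
  field_simp

end Potentials

/-! ### Test functions and the spectral support -/

section TestFunctions

variable {C μ₀ : ℝ} {u : Space} {Ω Ω' : Set Event} {g : Event → ℂ}

lemma IsTest.mono (hg : IsTest Ω g) (h : Ω ⊆ Ω') : IsTest Ω' g :=
  ⟨hg.1, hg.2.1, hg.2.2.trans h⟩

/-- A test function as a Schwartz function. -/
def IsTest.toSchwartz (hg : IsTest Ω g) : 𝓢(Event, ℂ) := hg.2.1.toSchwartzMap hg.1

@[simp] lemma IsTest.coe_toSchwartz (hg : IsTest Ω g) : ⇑hg.toSchwartz = g := rfl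

lemma IsTest.comp_equiv (hg : IsTest Ω g) (A : Event ≃L[ℝ] Event) :
    IsTest (A ⁻¹' Ω) (fun p => g (A p)) := by
  refine ⟨hg.1.comp A.contDiff, hg.2.1.comp_homeomorph A.toHomeomorph, ?_⟩
  have : tsupport (fun p => g (A p)) = A ⁻¹' tsupport g :=
    tsupport_comp_eq_preimage g A.toHomeomorph
  rw [this]
  exact Set.preimage_mono hg.2.2

lemma IsTest.comp_boostWave (hC : 0 < C) (hu : ‖u‖ < C) (hg : IsTest Ω g) :
    IsTest (boostWave C u ⁻¹' Ω) (fun p => g (boostWave C u p)) := by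
  have h := hg.comp_equiv (boostWaveEquiv hC hu)
  have e : ⇑(boostWaveEquiv hC hu) = boostWave C u := funext (boostWaveEquiv_apply hC hu)
  rwa [e] at h

lemma contDiff_symbol (C : ℝ) : ContDiff ℝ ∞ (symbol C) := (hasTemperateGrowth_symbol C).1

lemma IsTest.symbol_smul (hg : IsTest Ω g) (C : ℝ) : IsTest Ω (fun p => symbol C p • g p) :=
  have hs : tsupport (fun p => symbol C p • g p) ⊆ tsupport g := tsupport_smul_subset_right _ _
  ⟨(contDiff_symbol C).smul hg.1, IsCompact.of_isClosed_subset hg.2.1 (isClosed_tsupport _) hs,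
    hs.trans hg.2.2⟩

/-- A test function vanishing near the light cone can be divided by the symbol of the wave
operator. -/
lemma IsTest.symbol_inv_smul (hg : IsTest Ω g) (hΩ : ∀ p ∈ Ω, symbol C p ≠ 0) :
    IsTest Ω (fun p => (symbol C p)⁻¹ • g p) := by
  have hs : tsupport (fun p => (symbol C p)⁻¹ • g p) ⊆ tsupport g :=
    tsupport_smul_subset_right _ _
  refine ⟨contDiff_iff_contDiffAt.2 fun p => ?_,
    IsCompact.of_isClosed_subset hg.2.1 (isClosed_tsupport _) hs, hs.trans hg.2.2⟩
  by_cases hp : p ∈ tsupport g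
  · exact ((contDiff_symbol C).contDiffAt.inv (hΩ p (hg.2.2 hp))).smul hg.1.contDiffAt
  · exact contDiffAt_const.congr_of_eventuallyEq
      (notMem_tsupport_iff_eventuallyEq.1 fun h => hp (hs h))

lemma spectrum_retarded_symbol_smul (hC : 0 < C) (J : 𝓢(Event, FourVec ℂ)) (hg : IsTest Ω g) :
    spectrum (retarded C μ₀ J) (fun p => symbol C p • g p) =
      (μ₀ * C ^ 2) • ∫ p, g p • fourierT J p := by
  rw [← hg.coe_toSchwartz, ← spectrum_retarded_symbol_mul hC]
  congr 1
  ext1 p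
  rw [smulLeftCLM_apply_apply (hasTemperateGrowth_symbol C)]

/-- Off the light cone, the spectrum of the retarded potentials is a smooth function. -/
lemma spectrum_retarded_of_symbol_ne_zero (hC : 0 < C) (J : 𝓢(Event, FourVec ℂ))
    (hg : IsTest Ω g) (hΩ : ∀ p ∈ Ω, symbol C p ≠ 0) :
    spectrum (retarded C μ₀ J) g =
      ∫ p, g p • ((μ₀ * C ^ 2 / (C ^ 2 * ‖p.1‖ ^ 2 - p.2 ^ 2)) • fourierT J p) := by
  have h := spectrum_retarded_symbol_smul (μ₀ := μ₀) hC J (hg.symbol_inv_smul hΩ)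
  have e : (fun p => symbol C p • (symbol C p)⁻¹ • g p) = g := by
    ext1 p
    by_cases hp : p ∈ tsupport g
    · rw [smul_inv_smul₀ (hΩ p (hg.2.2 hp))]
    · simp [image_eq_zero_of_notMem_tsupport hp]
  rw [e] at h
  rw [h, ← integral_smul]
  refine integral_congr_ae (Eventually.of_forall fun p => ?_)
  simp only
  rw [smul_assoc, smul_smul, smul_comm (g p)]
  rfl

lemma lorentz_eq_zero_iff (hC : 0 < C) (hu : ‖u‖ < C) {Z : FourVec ℂ} :
    lorentz C u Z = 0 ↔ Z = 0 := by
  rw [← lorentzEquiv_apply hC hu]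
  exact (lorentzEquiv ℂ hC hu).map_eq_zero_iff

/-- The retarded potentials have the same spectral support as the source: the spectrum of the
potentials is a multiple of that of the source by the convolution theorem, and conversely by the
wave equation. -/
lemma distSupport_retarded (hC : 0 < C) (hμ : 0 < μ₀) (J : 𝓢(Event, FourVec ℂ)) :
    distSupport (spectrum (retarded C μ₀ J)) = tsupport (fourierT J) := by
  refine Set.Subset.antisymm (fun p hp => ?_) fun p hp => ?_
  · by_contra hpJ
    obtain ⟨g, hg, hne⟩ := hp _ ((isClosed_tsupport _).isOpen_compl.mem_nhds hpJ)
    apply hne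
    have h0 : windowed J hg.toSchwartz = 0 := by
      ext1 q
      rw [windowed_apply, hg.coe_toSchwartz, zero_apply]
      by_cases hq : q ∈ tsupport g
      · rw [image_eq_zero_of_notMem_tsupport (hg.2.2 hq), smul_zero]
      · rw [image_eq_zero_of_notMem_tsupport hq, zero_smul]
    have h := spectrum_retarded (C := C) (μ₀ := μ₀) J hg.toSchwartz
    rw [hg.coe_toSchwartz] at h
    rw [h, h0, map_zero]
    simp
  · intro U hU
    by_contra! hno
    have hcont : Continuous (fourierT J) := by
      rw [← coe_fourierCLM]; exact (fourierCLM (FourVec ℂ) J).continuous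
    have hzero : ∀ g, IsTest (interior U) g → ∫ q, g q • fourierT J q = 0 := fun g hg => by
      have h := hno _ ((hg.symbol_smul C).mono interior_subset)
      rw [spectrum_retarded_symbol_smul hC J hg] at h
      exact (smul_eq_zero_iff_right (by positivity)).1 h
    have hae := isOpen_interior.ae_eq_zero_of_integral_contDiff_smul_eq_zero
      (μ := (volume : Measure Event)) (U := interior U) (f := fourierT J)
      (hcont.locallyIntegrable.locallyIntegrableOn _) (fun g g1 g2 g3 => by
        have hs : tsupport (fun q => (g q : ℂ)) ⊆ tsupport g :=
          closure_mono fun q hq h0 => hq (by simp [h0])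
        have := hzero (fun q => (g q : ℂ))
          ⟨Complex.ofRealCLM.contDiff.comp g1, g2.comp_left (g := Complex.ofReal) (by simp),
            hs.trans g3⟩
        simpa using this)
    have heq : Set.EqOn (fourierT J) 0 (interior U) :=
      Measure.eqOn_open_of_ae_eq (μ := (volume : Measure Event))
        ((ae_restrict_iff' isOpen_interior.measurableSet).2 hae) isOpen_interior
        hcont.continuousOn continuousOn_const
    exact notMem_tsupport_iff_eventuallyEq.2
      (heq.eventuallyEq_of_mem (interior_mem_nhds.2 hU)) hp

/-- The spectral support of the perceived potentials is the boosted one of the source. -/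
lemma distSupport_perceived (hC : 0 < C) (hμ : 0 < μ₀) (hu : ‖u‖ < C) (J : 𝓢(Event, FourVec ℂ)) :
    distSupport (spectrum (perceived C μ₀ u J)) =
      boostWave C (-u) '' tsupport (fourierT J) := by
  have hu' : ‖-u‖ < C := by rwa [norm_neg]
  rw [← distSupport_retarded hC hμ]
  ext q
  constructor
  · intro hq
    refine ⟨boostWave C u q, fun U hU => ?_, boostWave_neg_boostWave hC hu q⟩
    obtain ⟨g, hg, hne⟩ := hq (boostWave C u ⁻¹' U)
      ((continuous_boostWave hC hu).continuousAt.preimage_mem_nhds hU)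
    refine ⟨_, (hg.comp_boostWave hC hu').mono fun p hp => ?_, ?_⟩
    · simpa only [Set.mem_preimage, boostWave_boostWave_neg hC hu] using hp
    · rwa [spectrum_perceived hC hu, Ne, lorentz_eq_zero_iff hC hu'] at hne
  · rintro ⟨p, hp, rfl⟩ U hU
    obtain ⟨g, hg, hne⟩ := hp (boostWave C (-u) ⁻¹' U)
      ((continuous_boostWave hC hu').continuousAt.preimage_mem_nhds hU)
    refine ⟨_, (hg.comp_boostWave hC hu).mono fun p hp => ?_, ?_⟩
    · simpa only [Set.mem_preimage, boostWave_neg_boostWave hC hu] using hp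
    · rw [spectrum_perceived hC hu, Ne, lorentz_eq_zero_iff hC hu']
      simpa only [boostWave_boostWave_neg hC hu] using hne

end TestFunctions

/-! ### Spectral peaks -/

section Peaks

variable {C μ₀ : ℝ} {u : Space} {ι : Type} {l : Filter ι} {J : ι → 𝓢(Event, FourVec ℂ)}
  {Ω : Set Event} {p : Event}

/-- Smooth local convergence of the source spectra to zero gives convergence in the Schwartz
space after multiplication by a test function. -/
lemma tendsto_windowed {g : Event → ℂ} (hg : IsTest Ω g)
    (h : ∀ m : ℕ, TendstoLocallyUniformlyOn
      (fun i q => iteratedFDeriv ℝ m (fourierT (J i)) q) 0 l Ω) :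
    Tendsto (fun i => windowed (J i) hg.toSchwartz) l (𝓝 0) := by
  rw [(schwartz_withSeminorms ℝ Event (FourVec ℂ)).tendsto_nhds]
  rintro ⟨k, n⟩ ε hε
  set A : ℝ := ∑ m ∈ Finset.range (n + 1),
    (n.choose m : ℝ) * SchwartzMap.seminorm ℝ k m hg.toSchwartz
  have hA : 0 ≤ A := Finset.sum_nonneg fun m _ => by positivity
  have hη : 0 < ε / (2 * (A + 1)) := by positivity
  have hev : ∀ᶠ i in l, ∀ m ∈ Finset.range (n + 1), ∀ q ∈ tsupport g,
      ‖iteratedFDeriv ℝ m (fourierT (J i)) q‖ < ε / (2 * (A + 1)) := by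
    rw [eventually_all_finset]
    intro m _
    have hu := (tendstoLocallyUniformlyOn_iff_tendstoUniformlyOn_of_compact hg.2.1).1
      ((h m).mono hg.2.2)
    filter_upwards [Metric.tendstoUniformlyOn_iff.1 hu _ hη] with i hi q hq
    simpa using hi q hq
  filter_upwards [hev] with i hi
  rw [sub_zero, schwartzSeminormFamily_apply]
  refine lt_of_le_of_lt (SchwartzMap.seminorm_le_bound ℝ k n _ (M := A * (ε / (2 * (A + 1))))
    (by positivity) fun q => ?_) ?_
  · have hw : ⇑(windowed (J i) hg.toSchwartz) = fun q => g q • fourierT (J i) q :=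
      funext (windowed_apply (J i) hg.toSchwartz)
    rw [hw]
    by_cases hq : q ∈ tsupport g
    · have hF : ContDiff ℝ n (fourierT (J i)) := by
        rw [← coe_fourierCLM]; exact (fourierCLM (FourVec ℂ) (J i)).smooth n
      have hb := norm_iteratedFDeriv_smul_le (𝕜 := ℝ) (hg.toSchwartz.smooth n) hF q le_rfl
      calc ‖q‖ ^ k * ‖iteratedFDeriv ℝ n (fun q => g q • fourierT (J i) q) q‖
          ≤ ‖q‖ ^ k * ∑ m ∈ Finset.range (n + 1), (n.choose m : ℝ) *
              ‖iteratedFDeriv ℝ m hg.toSchwartz q‖ *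
              ‖iteratedFDeriv ℝ (n - m) (fourierT (J i)) q‖ := by gcongr; exact hb
        _ = ∑ m ∈ Finset.range (n + 1), (n.choose m : ℝ) *
              (‖q‖ ^ k * ‖iteratedFDeriv ℝ m hg.toSchwartz q‖) *
              ‖iteratedFDeriv ℝ (n - m) (fourierT (J i)) q‖ := by
            rw [Finset.mul_sum]
            exact Finset.sum_congr rfl fun m _ => by ring
        _ ≤ ∑ m ∈ Finset.range (n + 1), (n.choose m : ℝ) *
              SchwartzMap.seminorm ℝ k m hg.toSchwartz * (ε / (2 * (A + 1))) := by
            refine Finset.sum_le_sum fun m _ => ?_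
            gcongr
            · exact SchwartzMap.le_seminorm ℝ k m hg.toSchwartz q
            · exact (hi (n - m) (Finset.mem_range.2 (by omega)) q hq).le
        _ = A * (ε / (2 * (A + 1))) := by rw [← Finset.sum_mul]
    · have hs : tsupport (fun q => g q • fourierT (J i) q) ⊆ tsupport g :=
        tsupport_smul_subset_left _ _
      have : iteratedFDeriv ℝ n (fun q => g q • fourierT (J i) q) q = 0 :=
        image_eq_zero_of_notMem_tsupport fun h' => hq (hs (tsupport_iteratedFDeriv_subset n h'))
      rw [this, norm_zero, mul_zero]
      positivity
  · calc A * (ε / (2 * (A + 1))) ≤ (A + 1) * (ε / (2 * (A + 1))) := by gcongr; linarith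
      _ = ε / 2 := by field_simp
      _ < ε := by linarith

lemma tendsto_spectrum_retarded {g : Event → ℂ} (hg : IsTest Ω g)
    (h : ∀ m : ℕ, TendstoLocallyUniformlyOn
      (fun i q => iteratedFDeriv ℝ m (fourierT (J i)) q) 0 l Ω) :
    Tendsto (fun i => spectrum (retarded C μ₀ (J i)) g) l (𝓝 0) := by
  have h1 := ((integralCLM ℂ (lightCone C)).continuous.comp
    (fourierCLM (FourVec ℂ)).continuous).tendsto 0
  have h2 := (h1.comp (tendsto_windowed hg h)).const_smul
    (μ₀ / (4 * Real.pi) * (2 * Real.pi) ^ 2)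
  simp only [Function.comp_apply, map_zero, smul_zero] at h2
  refine h2.congr fun i => ?_
  have := spectrum_retarded (C := C) (μ₀ := μ₀) (J i) hg.toSchwartz
  rw [hg.coe_toSchwartz] at this
  rw [this]
  rfl

/-- The spectra of the perceived potentials do not fade out at the boosted wave data: the wave
equation turns a test function detecting the source into one detecting its potentials. -/
lemma persistsAt_perceived (hC : 0 < C) (hμ : 0 < μ₀) (hu : ‖u‖ < C)
    (h : PersistsAt l (fun i g => ∫ q : Event, g q • fourierT (J i) q) p) :
    PersistsAt l (fun i => spectrum (perceived C μ₀ u (J i))) (boostWave C (-u) p) := by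
  have hu' : ‖-u‖ < C := by rwa [norm_neg]
  intro U hU
  obtain ⟨g, hg, δ, hδ, hev⟩ := h _
    ((continuous_boostWave hC hu').continuousAt.preimage_mem_nhds hU)
  set K : ℝ := ‖(lorentzEquiv ℂ hC hu : FourVec ℂ →L[ℂ] FourVec ℂ)‖
  have hK : 0 ≤ K := norm_nonneg _
  -- a boost contracts by at most the norm of its inverse, whence the constant below
  refine ⟨_, ((hg.symbol_smul C).comp_boostWave hC hu).mono fun q hq => ?_,
    μ₀ * C ^ 2 * δ / (K + 1), by positivity, ?_⟩
  · simpa only [Set.mem_preimage, boostWave_neg_boostWave hC hu] using hq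
  filter_upwards [hev] with i hi
  rw [spectrum_perceived hC hu]
  simp only [boostWave_boostWave_neg hC hu]
  rw [spectrum_retarded_symbol_smul hC (J i) hg]
  set v := ∫ q, g q • fourierT (J i) q
  have h1 : ‖(μ₀ * C ^ 2) • v‖ ≤ K * ‖lorentz C (-u) ((μ₀ * C ^ 2) • v)‖ := by
    have := (lorentzEquiv ℂ hC hu : FourVec ℂ →L[ℂ] FourVec ℂ).le_opNorm
      (lorentz C (-u) ((μ₀ * C ^ 2) • v))
    rwa [ContinuousLinearEquiv.coe_coe, lorentzEquiv_apply, lorentz_lorentz_neg hC hu] at this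
  rw [norm_smul, Real.norm_of_nonneg (by positivity)] at h1
  rw [div_le_iff₀ (by positivity)]
  have h2 : μ₀ * C ^ 2 * δ ≤ μ₀ * C ^ 2 * ‖v‖ := by gcongr
  nlinarith [norm_nonneg (lorentz C (-u) ((μ₀ * C ^ 2) • v))]

/-- The Doppler effect for spectral peaks. -/
lemma spectrumPeaksAt_perceived (hC : 0 < C) (hμ : 0 < μ₀) (hu : ‖u‖ < C)
    (h : EmitsWaves l J Ω p) :
    SpectrumPeaksAt l (fun i => spectrum (perceived C μ₀ u (J i)))
      (boostWave C (-u) '' Ω) (boostWave C (-u) p) := by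
  have hu' : ‖-u‖ < C := by rwa [norm_neg]
  refine ⟨Set.mem_image_of_mem _ h.1, persistsAt_perceived hC hμ hu h.2.1, fun g hg => ?_⟩
  have inj : Function.Injective (boostWave C (-u)) :=
    Function.LeftInverse.injective (boostWave_boostWave_neg hC hu)
  have hg' : IsTest (Ω \ {p}) (fun q => g (boostWave C (-u) q)) := by
    refine (hg.comp_boostWave hC hu').mono ?_
    rintro q ⟨hq, hq'⟩
    exact ⟨(inj.mem_set_image).1 hq, fun h0 => hq' (congrArg _ h0)⟩
  have h1 := (lorentzEquiv ℂ hC hu').continuous.tendsto 0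
  rw [map_zero] at h1
  refine (h1.comp (tendsto_spectrum_retarded (C := C) (μ₀ := μ₀) hg' h.2.2)).congr fun i => ?_
  exact (spectrum_perceived hC hu (J i) g).symm

end Peaks

end Doppler

end

theorem mainTheorem2 (C μ₀ : ℝ) (hC : 0 < C) (hμ : 0 < μ₀)
    (u : Doppler.Space) (hu : ‖u‖ < C) :
    -- the perceived potentials of every rapidly decreasing current-charge, and their spectrum
    (∀ J : SchwartzMap Doppler.Event (Doppler.FourVec ℂ),
      (∀ X : Doppler.Event, MeasureTheory.Integrable
        (Doppler.retardedIntegrand C (Doppler.inferred C u J) X)) ∧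
      Continuous (Doppler.perceived C μ₀ u J) ∧
      (∃ M : ℝ, ∀ X : Doppler.Event, ‖Doppler.perceived C μ₀ u J X‖ ≤ M) ∧
      (∀ g : SchwartzMap Doppler.Event ℂ,
        Doppler.spectrum (Doppler.perceived C μ₀ u J) g =
          Doppler.lorentz C (-u) (Doppler.spectrum (Doppler.perceived C μ₀ 0 J)
            (fun p => g (Doppler.boostWave C (-u) p)))) ∧
      (∀ g : Doppler.Event → ℂ,
        Doppler.IsTest {q | q.2 ^ 2 ≠ C ^ 2 * ‖q.1‖ ^ 2} g →
        Doppler.spectrum (Doppler.perceived C μ₀ u J) g =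
          ∫ p : Doppler.Event, g (Doppler.boostWave C (-u) p) •
            ((μ₀ * C ^ 2 / (C ^ 2 * ‖p.1‖ ^ 2 - p.2 ^ 2)) •
              Doppler.lorentz C (-u) (Doppler.fourierT J p))) ∧
      Doppler.distSupport (Doppler.spectrum (Doppler.perceived C μ₀ u J)) =
        Doppler.boostWave C (-u) '' tsupport (Doppler.fourierT J)) ∧
    -- the Doppler shift of the spectral peak
    (∀ (ι : Type) (l : Filter ι) (J : ι → SchwartzMap Doppler.Event (Doppler.FourVec ℂ))
      (Ω : Set Doppler.Event) (k k' : Doppler.Space) (w w' : ℝ),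
      IsOpen Ω → Doppler.EmitsWaves l J Ω (k, w) →
      (k', w' / C) = Doppler.lorentz C (-u) (k, w / C) →
      Doppler.SpectrumPeaksAt l (fun i => Doppler.spectrum (Doppler.perceived C μ₀ u (J i)))
          (Doppler.boostWave C (-u) '' Ω) (k', w') ∧
        w' = Doppler.gam C u * (w - inner ℝ k u)) := by
  have hu' : ‖-u‖ < C := by rwa [norm_neg]
  refine ⟨fun J => ⟨Doppler.integrable_retardedIntegrand hC hu J, ?_, ?_, fun g => ?_,
    fun g hg => ?_, Doppler.distSupport_perceived hC hμ hu J⟩, ?_⟩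
  · rw [funext (Doppler.perceived_eq (μ₀ := μ₀) hC hu J)]
    exact (Doppler.lorentzEquiv ℂ hC hu').continuous.comp
      ((Doppler.continuous_retarded J).comp
        ((Doppler.boostEventEquiv hC hu).continuous.congr (Doppler.boostEventEquiv_apply hC hu)))
  · obtain ⟨M, hM⟩ := Doppler.exists_norm_retarded_le (C := C) (μ₀ := μ₀) J
    set A := (Doppler.lorentzEquiv ℂ hC hu').toContinuousLinearMap
    refine ⟨‖A‖ * M, fun X => ?_⟩
    rw [Doppler.perceived_eq hC hu]
    exact (A.le_opNorm _).trans (by gcongr; exact hM _)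
  · rw [Doppler.spectrum_perceived hC hu, Doppler.perceived_zero hC]
  · have hg' := hg.comp_boostWave hC hu'
    rw [Doppler.spectrum_perceived hC hu,
      Doppler.spectrum_retarded_of_symbol_ne_zero hC J hg' fun p hp h0 => hp ?_]
    · have h := (Doppler.lorentzEquiv ℂ hC hu').integral_comp_comm (μ := MeasureTheory.volume)
        (fun p => g (Doppler.boostWave C (-u) p) •
          ((μ₀ * C ^ 2 / (C ^ 2 * ‖p.1‖ ^ 2 - p.2 ^ 2)) • Doppler.fourierT J p))
      simp only [Doppler.lorentzEquiv_apply] at h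
      rw [← h]
      refine MeasureTheory.integral_congr_ae (Filter.Eventually.of_forall fun p => ?_)
      simp only
      rw [Doppler.lorentz_smul, ← Complex.coe_smul, ← Complex.coe_smul, Doppler.lorentz_smul]
    · have := Doppler.symbol_boostWave hC hu' p
      rw [Doppler.symbol] at h0
      linarith
  · intro ι l J Ω k k' w w' _ hJ hk
    have hk' : (k', w') = Doppler.boostWave C (-u) (k, w) := by
      rw [Doppler.boostWave, ← hk, mul_div_cancel₀ _ hC.ne']
    refine ⟨hk' ▸ Doppler.spectrumPeaksAt_perceived hC hμ hu hJ, ?_⟩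
    have h2 := congrArg Prod.snd hk'
    simp only [Doppler.boostWave, Doppler.lorentz, Doppler.gam_neg, Doppler.dot_neg_left,
      Doppler.dot_real, RCLike.ofReal_real_eq_id, id_eq] at h2
    rw [h2, real_inner_comm]
    field_simp
    ring
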